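/- Rings are commutative with $1$, $[a,b]=ab-ba$, and $\mathbb N^*=\{1,2,\ldots\}$. A truncation set is a set $P\subseteq\mathbb N^*$ containing every divisor of each of its elements. Let $\mathcal I_P$ be the set of finitely supported families $i=(i_n)_{n\in P}$ of non-negative integers; for $x=(x_n)_{n\in P}$ put $x^i=\prod_n x_n^{i_n}$. Let $w_n(x)=\sum_{d\mid n}d\,x_d^{n/d}$ be the ghost components and $\Lambda(x;t)=\prod_{n\ge1}(1-x_nt^n)^{-1}$. Write $D^*(n)$ for the set of divisors of $n$ other than $n$, and $S[X][Y]$ for the set of normally ordered polynomials $\sum_{i,j} a_{i,j}X^iY^j$ (finite sums, $a_{i,j}\in S$) in $X=(X_d)_{d\ge1}$, $Y=(Y_e)_{e\ge1}$. For truncation sets $P,Q$ and a ring $R$ in which all elements of $P\cup Q$ are invertible, let $B_{P,Q}(R)$ be the $R$-algebra generated by $x=(x_m)_{m\in P}$ and $y=(y_n)_{n\in Q}$ with the relations $[w_m(x),w_n(x)]=0$ $(m,n\in P)$, $[w_m(y),w_n(y)]=0$ $(m,n\in Q)$ and $[w_n(y),w_m(x)]=\delta_{m,n}m$ $(m\in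 P,\ n\in Q)$; let $B(R)=B_{\mathbb N^*,\mathbb N^*}(R)$. For every ring $R$ let $B'(R)$ be the $R$-algebra generated by $x=(x_m)_{m\ge1}$, $y=(y_n)_{n\ge1}$ with the relations $[x_m,x_n]=[y_m,y_n]=0$ and $\Lambda(y;t)\Lambda(x;s)=\Lambda(x;s)\Lambda(y;t)(1-st)^{-1}$, where $s,t$ are central variables. Theorem. (a) $B(\mathbb Q)=B'(\mathbb Q)$, i.e. there is an isomorphism of $\mathbb Q$-algebras sending $x_m$ to $x_m$ and $y_n$ to $y_n$ for all $m,n$. (b) There are polynomials $c_{m,n}\in\mathbb Z[X_d\mid d\in D^*(m)][Y_e\mid e\in D^*(n)]$ $(m,n\in\mathbb N^*)$ such that: (i) $p=c_{m,n}$ is the only $p\in\mathbb Q[X][Y]$ with $[y_n,x_m]=p(x,y)$ in $B(\mathbb Q)$, and also the only $p\in\mathbb Q[X][Y]$ with $[y_n,x_m]=p(x,y)$ in $B'(\mathbb Q)$; (ii) $[y_n,x_m]=c_{m,n}(x,y)$ in $B'(R)$ for every ring $R$ and all $m,n\in\mathbb N^*$, and in $B_{P,Q}(R)$ for all truncation sets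 $P,Q$, every ring $R$ in which all elements of $P\cup Q$ are invertible, and all $m\in P$, $n\in Q$. (c) For every ring $R$ and all truncation sets $P,Q$ let $B^{c}_{P,Q}(R)$ be the $R$-algebra generated by $x=(x_m)_{m\in P}$, $y=(y_n)_{n\in Q}$ with the relations $[x_m,x_n]=0$, $[y_m,y_n]=0$ and $[y_n,x_m]=c_{m,n}(x,y)$. If all elements of $P\cup Q$ are invertible in $R$, then $B^{c}_{P,Q}(R)=B_{P,Q}(R)$ (isomorphic as $R$-algebras, generators corresponding to generators). For every ring $R$ and all truncation sets $P,Q$, the products $x^iy^j$ with $i\in\mathcal I_P$, $j\in\mathcal I_Q$ form an $R$-basis of $B^{c}_{P,Q}(R)$. -/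

import Mathlib

universe u

noncomputable section

namespace UnivB

/-! ### Monomials and normally ordered polynomials -/

/-- The product `x^i = ∏ x_n ^ (i_n)` over the (finite) support of `i`, with factors taken in
increasing order of the index; when the `x_n` commute the order is irrelevant. -/
def mono {ι A : Type*} [LinearOrder ι] [Monoid A] (x : ι → A) (i : ι →₀ ℕ) : A :=
  (i.support.sort.map fun n => x n ^ i n).prod

/-- `S[X][Y]`, with `X = (X_1, X_2, …)` and `Y = (Y_1, Y_2, …)`: finite sums
`∑ a_{i,j} X^i Y^j`, stored through their coefficients `a_{i,j}`. -/
abbrev OrdPoly (S : Type*) [CommRing S] : Type _ :=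
  ((ℕ+ →₀ ℕ) × (ℕ+ →₀ ℕ)) →₀ S

/-- The value `p(x,y) = ∑ a_{i,j} x^i y^j` of `p ∈ S[X][Y]` in an `S`-algebra. -/
def OrdPoly.eval {S A : Type*} [CommRing S] [Ring A] [Algebra S A]
    (p : OrdPoly S) (x y : ℕ+ → A) : A :=
  p.sum fun ij a => a • (mono x ij.1 * mono y ij.2)

/-- The inclusion `ℤ[X][Y] ⊆ ℚ[X][Y]`. -/
def OrdPoly.toRat (p : OrdPoly ℤ) : OrdPoly ℚ :=
  p.mapRange (fun a : ℤ => (a : ℚ)) Int.cast_zero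

/-- `p ∈ S[X_d ∣ d ∈ D*(m)][Y_e ∣ e ∈ D*(n)]`, where `D*(m)` is the set of the
divisors of `m` other than `m`. -/
def OrdPoly.InProperDivisors {S : Type*} [CommRing S] (p : OrdPoly S) (m n : ℕ+) : Prop :=
  ∀ ij ∈ p.support, (∀ d ∈ ij.1.support, d ∣ m ∧ d ≠ m) ∧ (∀ e ∈ ij.2.support, e ∣ n ∧ e ≠ n)

/-! ### Truncation sets, generators, ghost components -/

/-- A truncation set: a set of positive integers closed under taking divisors. -/
def IsTruncationSet (P : Set ℕ+) : Prop :=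
  ∀ n ∈ P, ∀ d : ℕ+, d ∣ n → d ∈ P

/-- The ghost component `w_n(x) = ∑_{d ∣ n} d x_d^{n/d}`. -/
def ghost {A : Type*} [Ring A] (x : ℕ+ → A) (n : ℕ+) : A :=
  ∑ d ∈ (Finset.Icc 1 n).filter (fun d : ℕ+ => (d : ℕ) ∣ (n : ℕ)),
    ((d : ℕ) : A) * x d ^ ((n : ℕ) / (d : ℕ))

/-- The free `R`-algebra `R⟨x, y⟩` on `x = (x_m)_{m ∈ P}` and `y = (y_n)_{n ∈ Q}`. -/
abbrev Free (R : Type u) [CommRing R] (P Q : Set ℕ+) : Type u :=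
  FreeAlgebra R (P ⊕ Q)

open Classical in
/-- The free generator `x_m` for `m ∈ P`; set to `0` for `m ∉ P` (for truncation sets these
values never enter the relations below). -/
def fx (R : Type u) [CommRing R] (P Q : Set ℕ+) (m : ℕ+) : Free R P Q :=
  if h : m ∈ P then FreeAlgebra.ι R (Sum.inl ⟨m, h⟩) else 0

open Classical in
/-- The free generator `y_n` for `n ∈ Q`; set to `0` for `n ∉ Q`. -/
def fy (R : Type u) [CommRing R] (P Q : Set ℕ+) (n : ℕ+) : Free R P Q :=
  if h : n ∈ Q then FreeAlgebra.ι R (Sum.inr ⟨n, h⟩) else 0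

/-! ### The algebra defined through ghost components -/

/-- The relations `[w_m(x), w_n(x)] = 0`, `[w_m(y), w_n(y)] = 0`,
`[w_n(y), w_m(x)] = δ_{m,n} m`. -/
inductive GhostRel (R : Type u) [CommRing R] (P Q : Set ℕ+) : Free R P Q → Free R P Q → Prop
  | xx (m n : ℕ+) (hm : m ∈ P) (hn : n ∈ P) :
      GhostRel R P Q ⁅ghost (fx R P Q) m, ghost (fx R P Q) n⁆ 0
  | yy (m n : ℕ+) (hm : m ∈ Q) (hn : n ∈ Q) :
      GhostRel R P Q ⁅ghost (fy R P Q) m, ghost (fy R P Q) n⁆ 0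
  | yx (m n : ℕ+) (hm : m ∈ P) (hn : n ∈ Q) :
      GhostRel R P Q ⁅ghost (fy R P Q) n, ghost (fx R P Q) m⁆
        (if m = n then ((m : ℕ) : Free R P Q) else 0)

/-- `B_{P,Q}(R)` through ghost components; to be used when all elements of `P` and `Q` are
invertible in `R`. -/
abbrev GhostB (R : Type u) [CommRing R] (P Q : Set ℕ+) : Type u :=
  RingQuot (GhostRel R P Q)

/-- The generators `x_m` of `GhostB R P Q`. -/
def GhostB.x (R : Type u) [CommRing R] (P Q : Set ℕ+) (m : ℕ+) : GhostB R P Q :=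
  RingQuot.mkAlgHom R (GhostRel R P Q) (fx R P Q m)

/-- The generators `y_n` of `GhostB R P Q`. -/
def GhostB.y (R : Type u) [CommRing R] (P Q : Set ℕ+) (n : ℕ+) : GhostB R P Q :=
  RingQuot.mkAlgHom R (GhostRel R P Q) (fy R P Q n)

/-! ### The algebra defined through the series `Λ` -/

/-- The series `Λ(x; T_v) = ∏_{n ≥ 1} (1 - x_n T_v^n)⁻¹` in the central variable `T_v`, as a
power series in the central variables `(T_w)_w`. Since the `n`-th factor is `1` modulo `T_v^n`,
the coefficient of a monomial `T^k` is read off from the product of the factors with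
`n = 1, …, k_v`, taken in this order (the order is irrelevant if the `x_n` commute). -/
def Lam {σ A : Type*} [Ring A] (x : ℕ+ → A) (v : σ) : MvPowerSeries σ A := fun k =>
  MvPowerSeries.coeff k
    ((List.range (k v)).map fun n =>
      MvPowerSeries.invOfUnit
        (1 - MvPowerSeries.monomial (Finsupp.single v (n + 1)) (x n.succPNat)) 1).prod

/-- `(1 - st)⁻¹` in `A[[s, t]]`, where `s` and `t` are the variables of index `0` and `1`. -/
def geomST (A : Type*) [Ring A] : MvPowerSeries (Fin 2) A :=
  MvPowerSeries.invOfUnit (1 - MvPowerSeries.X 0 * MvPowerSeries.X 1) 1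

/-- The relations `[x_m, x_n] = [y_m, y_n] = 0` and (coefficient by coefficient)
`Λ(y;t) Λ(x;s) = Λ(x;s) Λ(y;t) (1 - st)⁻¹`, for generators indexed by all positive integers. -/
inductive LamRel (R : Type u) [CommRing R] :
    Free R Set.univ Set.univ → Free R Set.univ Set.univ → Prop
  | xx (m n : ℕ+) : LamRel R ⁅fx R Set.univ Set.univ m, fx R Set.univ Set.univ n⁆ 0
  | yy (m n : ℕ+) : LamRel R ⁅fy R Set.univ Set.univ m, fy R Set.univ Set.univ n⁆ 0
  | lam (k : Fin 2 →₀ ℕ) :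
      LamRel R
        (MvPowerSeries.coeff k
          (Lam (fy R Set.univ Set.univ) 1 * Lam (fx R Set.univ Set.univ) 0))
        (MvPowerSeries.coeff k
          (Lam (fx R Set.univ Set.univ) 0 * Lam (fy R Set.univ Set.univ) 1 * geomST _))

/-- The algebra `B'(R)`. -/
abbrev LamB (R : Type u) [CommRing R] : Type u := RingQuot (LamRel R)

/-- The generators `x_m` of `B'(R)`. -/
def LamB.x (R : Type u) [CommRing R] (m : ℕ+) : LamB R :=
  RingQuot.mkAlgHom R (LamRel R) (fx R Set.univ Set.univ m)

/-- The generators `y_n` of `B'(R)`. -/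
def LamB.y (R : Type u) [CommRing R] (n : ℕ+) : LamB R :=
  RingQuot.mkAlgHom R (LamRel R) (fy R Set.univ Set.univ n)

/-! ### The algebra defined through structure polynomials -/

/-- The relations `[x_m, x_n] = 0`, `[y_m, y_n] = 0`, `[y_n, x_m] = c_{m,n}(x, y)`. -/
inductive StructRel (c : ℕ+ → ℕ+ → OrdPoly ℤ) (R : Type u) [CommRing R] (P Q : Set ℕ+) :
    Free R P Q → Free R P Q → Prop
  | xx (m n : ℕ+) (hm : m ∈ P) (hn : n ∈ P) : StructRel c R P Q ⁅fx R P Q m, fx R P Q n⁆ 0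
  | yy (m n : ℕ+) (hm : m ∈ Q) (hn : n ∈ Q) : StructRel c R P Q ⁅fy R P Q m, fy R P Q n⁆ 0
  | yx (m n : ℕ+) (hm : m ∈ P) (hn : n ∈ Q) :
      StructRel c R P Q ⁅fy R P Q n, fx R P Q m⁆ ((c m n).eval (fx R P Q) (fy R P Q))

/-- The algebra generated by `x = (x_m)_{m ∈ P}` and `y = (y_n)_{n ∈ Q}` with the relations
given by a family `c` of polynomials with integer coefficients. -/
abbrev StructB (c : ℕ+ → ℕ+ → OrdPoly ℤ) (R : Type u) [CommRing R] (P Q : Set ℕ+) : Type u :=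
  RingQuot (StructRel c R P Q)

/-- The generators `x_m` of `StructB c R P Q`. -/
def StructB.x (c : ℕ+ → ℕ+ → OrdPoly ℤ) (R : Type u) [CommRing R] (P Q : Set ℕ+) (m : ℕ+) :
    StructB c R P Q :=
  RingQuot.mkAlgHom R (StructRel c R P Q) (fx R P Q m)

/-- The generators `y_n` of `StructB c R P Q`. -/
def StructB.y (c : ℕ+ → ℕ+ → OrdPoly ℤ) (R : Type u) [CommRing R] (P Q : Set ℕ+) (n : ℕ+) :
    StructB c R P Q :=
  RingQuot.mkAlgHom R (StructRel c R P Q) (fy R P Q n)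

end UnivB

end

noncomputable section

namespace UnivB

/-! ### Monomials in commuting families -/

section Mono

variable {ι κ R A B : Type*} [LinearOrder ι]

/-! Over `ℚ` the equations `w_n(x) = n x_n + (polynomial in x_d, d a proper divisor of n)` can be
solved recursively for the `x_n`. So `B(ℚ)` is an infinite Weyl algebra in the ghost components, and
it acts on the Fock space `ℚ[X, Y]`: `x_m` multiplies by `X_m`, and `w_n(y)` acts as multiplication
by `w_n(Y)` plus the derivation with `w_m(X) ↦ δ_{m,n} m`, `Y_k ↦ 0`. Applied to `1`, the monomial
`x^i y^j` gives `X^i Y^j`, so these monomials are independent (`GhostB.linearIndependent`). All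
uniqueness statements rest on this.

The logarithmic derivative of `Λ(x;s)` is `∑ w_n(x) s^n`. Solving the resulting linear differential
equations first in `s`, then in `t`, turns the Weyl relations into the `Λ`-relation
(`GhostRelations.lamRelations`), which gives a map from `B'(ℚ)` to `B(ℚ)`. In `B'(R)`, with `h_n`
the coefficients of `Λ`, the `Λ`-relation says `[h_{n+1}(y), h_{m+1}(x)] = h_n(y) h_m(x)`. This
permits normal ordering over every `R`, since the `h_n` generate the same algebra as the variables
without any division. Hence the monomials span `B'(R)`, and `B'(ℚ) → B(ℚ)` is bijective.

Normal ordering in `B'(ℤ)` yields integral `c_{m,n}`, which pass to all `B'(R)` by functoriality.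
Expanding `[y_n, x_m]` through ghost components in `B(ℚ)` shows that only proper divisors occur. For
`B_{P,Q}(R)` one replaces `R` by a localization of `ℤ` inside `ℚ`, where the coefficients can be
compared in `B(ℚ)`. Finally, the monomials span `B^c_{P,Q}(R)` because `c_{m,n}` only involves `y_e`
with `e < n`; they are independent over `ℤ` by mapping to `B(ℚ)`, and over `R` by base change. -/

theorem map_mono {F : Type*} [Monoid A] [Monoid B] [FunLike F A B] [MonoidHomClass F A B] (f : F)
    (x : ι → A) (i : ι →₀ ℕ) : f (mono x i) = mono (fun n => f (x n)) i := by
  simp [mono, map_list_prod, Function.comp_def]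

theorem mono_congr [Monoid A] {x x' : ι → A} {i : ι →₀ ℕ} (h : ∀ n ∈ i.support, x n = x' n) :
    mono x i = mono x' i := by
  unfold mono
  congr 1
  refine List.map_congr_left fun n hn => ?_
  rw [h n (by simpa using hn)]

theorem mono_eq_prod [CommMonoid A] (x : ι → A) (i : ι →₀ ℕ) :
    mono x i = i.prod fun n k => x n ^ k := by
  unfold mono Finsupp.prod
  rw [← List.prod_toFinset _ (Finset.sort_nodup _ _), Finset.sort_toFinset]

/-- The factors of `mono` are ordered by index and need not commute, so the reindexing has to
preserve the order: sorted supports then go to sorted supports. -/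
theorem mono_comp_embedding [LinearOrder κ] [Monoid A] (f : κ ↪o ι) (x : ι → A) (i : κ →₀ ℕ) :
    mono (fun k => x (f k)) i = mono x (i.embDomain f.toEmbedding) := by
  have hs : (i.embDomain f.toEmbedding).support.sort = i.support.sort.map f := by
    refine List.Perm.eq_of_pairwise (le := (· ≤ ·)) (fun a b _ _ h₁ h₂ => le_antisymm h₁ h₂)
      (Finset.pairwise_sort _ _) ?_ ?_
    · rw [List.pairwise_map]
      exact (Finset.pairwise_sort i.support (· ≤ ·)).imp fun h => f.monotone h
    · refine (List.perm_ext_iff_of_nodup (Finset.sort_nodup _ _)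
        ((Finset.sort_nodup _ _).map f.injective)).2 fun a => ?_
      simp
  unfold mono
  rw [hs, List.map_map]
  congr 1
  refine List.map_congr_left fun k _ => ?_
  have := Finsupp.embDomain_apply_self f.toEmbedding i k
  simp only [RelEmbedding.coe_toEmbedding] at this
  simp [Function.comp, this]

variable [CommRing R] [Ring A] [Algebra R A]

open scoped IsMulCommutative in
/-- Evaluation of polynomials at a commuting family in a noncommutative algebra. -/
theorem exists_commEval (x : κ → A) (hx : ∀ i j, Commute (x i) (x j)) :
    ∃ f : MvPolynomial κ R →ₐ[R] A, (∀ i, f (MvPolynomial.X i) = x i) ∧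
      f.range = Algebra.adjoin R (Set.range x) := by
  have := Algebra.isMulCommutative_adjoin R (s := Set.range x)
    (by rintro _ ⟨i, rfl⟩ _ ⟨j, rfl⟩; exact hx i j)

  let g : MvPolynomial κ R →ₐ[R] Algebra.adjoin R (Set.range x) :=
    MvPolynomial.aeval fun i => (⟨x i, Algebra.subset_adjoin ⟨i, rfl⟩⟩ : Algebra.adjoin R (Set.range x))
  have key : ∀ i, (Algebra.adjoin R (Set.range x)).val (g (MvPolynomial.X i)) = x i := by
    intro i; simp [g]
  refine ⟨(Algebra.adjoin R (Set.range x)).val.comp g, key, ?_⟩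
  rw [← Algebra.map_top, ← MvPolynomial.adjoin_range_X, AlgHom.map_adjoin, ← Set.range_comp]
  congr 2
  ext i
  exact key i

theorem map_monomial_eq_mono (f : MvPolynomial ι R →ₐ[R] A) (i : ι →₀ ℕ) (r : R) :
    f (MvPolynomial.monomial i r) = r • mono (fun n => f (MvPolynomial.X n)) i := by
  rw [← map_mono, mono_eq_prod, ← MvPolynomial.monic_monomial_eq, ← map_smul,
    MvPolynomial.smul_monomial, smul_eq_mul, mul_one]

theorem adjoin_eq_span_mono (x : ι → A) (hx : ∀ i j, Commute (x i) (x j)) :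
    Subalgebra.toSubmodule (Algebra.adjoin R (Set.range x)) =
      Submodule.span R (Set.range (mono x)) := by
  obtain ⟨f, hf, hr⟩ := exists_commEval (R := R) x hx
  apply le_antisymm
  · rw [← hr]
    rintro _ ⟨p, rfl⟩
    rw [p.as_sum]
    simp only [RingHom.coe_coe, AlgHom.toRingHom_eq_coe, map_sum]
    refine Submodule.sum_mem _ fun i _ => ?_
    rw [map_monomial_eq_mono, funext hf]
    exact Submodule.smul_mem _ _ (Submodule.subset_span ⟨i, rfl⟩)
  · rw [Submodule.span_le]
    rintro _ ⟨i, rfl⟩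
    rw [← hr]
    refine ⟨MvPolynomial.monomial i 1, ?_⟩
    simp only [RingHom.coe_coe, AlgHom.toRingHom_eq_coe]
    rw [map_monomial_eq_mono, one_smul, funext hf]

theorem commute_of_mem_adjoin {s : Set A} (hs : ∀ a ∈ s, ∀ b ∈ s, Commute a b) {a b : A}
    (ha : a ∈ Algebra.adjoin R s) (hb : b ∈ Algebra.adjoin R s) : Commute a b := by
  have := Algebra.isMulCommutative_adjoin R hs
  exact congrArg Subtype.val (mul_comm' (⟨a, ha⟩ : Algebra.adjoin R s) ⟨b, hb⟩)

end Mono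

/-! ### Normal ordering -/

section NormalOrder

variable {R A I J : Type*} [CommRing R] [Ring A] [Algebra R A]

theorem Subalgebra.mul_mem_of_mem_adjoin {s : Set A} {M : Submodule R A}
    (h : ∀ a ∈ s, ∀ z ∈ M, a * z ∈ M) {a z : A} (ha : a ∈ Algebra.adjoin R s) (hz : z ∈ M) :
    a * z ∈ M := by
  induction ha using Algebra.adjoin_induction generalizing z with
  | mem a ha => exact h a ha z hz
  | algebraMap r => rw [← Algebra.smul_def]; exact M.smul_mem r hz
  | add a b _ _ iha ihb => rw [add_mul]; exact M.add_mem (iha hz) (ihb hz)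
  | mul a b _ _ iha ihb => rw [mul_assoc]; exact iha (ihb hz)

/-- If the commutators `[v_n, u_m]` only involve the `u`s and the `v_e` with `e < n`, then every
element of the algebra generated by the `u`s and `v`s is a sum of products of an element of the
algebra generated by the `u`s and an element of the algebra generated by the `v`s. -/
theorem adjoin_union_le_mul [Preorder J] [WellFoundedLT J] (u : I → A) (v : J → A)
    (h : ∀ m n, v n * u m - u m * v n ∈ Algebra.adjoin R (Set.range u ∪ v '' Set.Iio n)) :
    Subalgebra.toSubmodule (Algebra.adjoin R (Set.range u ∪ Set.range v)) ≤
      Subalgebra.toSubmodule (Algebra.adjoin R (Set.range u)) *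
        Subalgebra.toSubmodule (Algebra.adjoin R (Set.range v)) := by
  set U := Algebra.adjoin R (Set.range u)
  set V := Algebra.adjoin R (Set.range v)
  set M := Subalgebra.toSubmodule U * Subalgebra.toSubmodule V
  have hu : ∀ a ∈ U, ∀ z ∈ M, a * z ∈ M := by
    intro a ha z hz
    induction hz using Submodule.mul_induction_on' with
    | mem_mul_mem b hb c hc =>
      rw [← mul_assoc]
      exact Submodule.mul_mem_mul (U.mul_mem ha hb) hc
    | add z _ z' _ ih ih' => rw [mul_add]; exact M.add_mem ih ih'
  have hVr : ∀ z ∈ M, ∀ c ∈ V, z * c ∈ M := by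
    intro z hz c hc
    induction hz using Submodule.mul_induction_on' with
    | mem_mul_mem b hb d hd =>
      rw [mul_assoc]
      exact Submodule.mul_mem_mul hb (V.mul_mem hd hc)
    | add z _ z' _ ih ih' => rw [add_mul]; exact M.add_mem ih ih'
  have h1 : (1 : A) ∈ M := by
    simpa using Submodule.mul_mem_mul (M := Subalgebra.toSubmodule U)
      (N := Subalgebra.toSubmodule V) U.one_mem V.one_mem
  have hUM : ∀ a ∈ U, a ∈ M := fun a ha => by simpa using hu a ha 1 h1
  have hVM : ∀ c ∈ V, c ∈ M := fun c hc => by simpa using hVr 1 h1 c hc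
  -- The crux, by induction on `n`: the commutator `[v n, u m]` is built from the `u`s and earlier
  -- `v`s, which already preserve `M` under left multiplication.
  have hv : ∀ n, ∀ z ∈ M, v n * z ∈ M := by
    intro n
    induction n using WellFoundedLT.induction with
    | ind n ih =>
      have hK : ∀ a ∈ Algebra.adjoin R (Set.range u ∪ v '' Set.Iio n), ∀ z ∈ M, a * z ∈ M := by
        intro a ha z hz
        refine Subalgebra.mul_mem_of_mem_adjoin ?_ ha hz
        rintro _ (⟨m, rfl⟩ | ⟨e, he, rfl⟩) z hz
        · exact hu _ (Algebra.subset_adjoin ⟨m, rfl⟩) z hz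
        · exact ih e he z hz
      -- The elements `a` past which `v n` can be moved in this sense are closed under sums and
      -- products, so the generators `u m` suffice.
      have hva : ∀ a ∈ U, ∀ b ∈ M, v n * b ∈ M → v n * (a * b) ∈ M := by
        intro a ha
        induction ha using Algebra.adjoin_induction with
        | mem a ha =>
          obtain ⟨m, rfl⟩ := ha
          intro b hb hvb
          have : v n * (u m * b) = (v n * u m - u m * v n) * b + u m * (v n * b) := by
            noncomm_ring
          rw [this]
          exact M.add_mem (hK _ (h m n) b hb) (hu _ (Algebra.subset_adjoin ⟨m, rfl⟩) _ hvb)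
        | algebraMap r =>
          intro b _ hvb
          rw [← Algebra.smul_def, mul_smul_comm]
          exact M.smul_mem r hvb
        | add a b _ _ iha ihb =>
          intro c hc hvc
          rw [add_mul, mul_add]
          exact M.add_mem (iha c hc hvc) (ihb c hc hvc)
        | mul a b _ hb iha ihb =>
          intro c hc hvc
          rw [mul_assoc]
          exact iha _ (hu b hb c hc) (ihb c hc hvc)
      intro z hz
      induction hz using Submodule.mul_induction_on' with
      | mem_mul_mem a ha c hc =>
        have hc' : c ∈ V := hc
        refine hva a ha c (hVM c hc) (hVM _ (V.mul_mem (Algebra.subset_adjoin ⟨n, rfl⟩) hc'))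
      | add z _ z' _ ih ih' => rw [mul_add]; exact M.add_mem ih ih'
  intro z hz
  rw [← mul_one z]
  refine Subalgebra.mul_mem_of_mem_adjoin ?_ hz h1
  rintro _ (⟨m, rfl⟩ | ⟨n, rfl⟩) z hz
  · exact hu _ (Algebra.subset_adjoin ⟨m, rfl⟩) z hz
  · exact hv n z hz

end NormalOrder

/-! ### Evaluation of normally ordered polynomials -/

namespace OrdPoly

variable {S A B : Type*} [CommRing S] [Ring A] [Algebra S A] [Ring B] [Algebra S B]

/-- `p ∈ S[X_d ∣ d ∈ P][Y_e ∣ e ∈ Q]`. -/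
def IsIn (p : OrdPoly S) (P Q : Set ℕ+) : Prop :=
  ∀ ij ∈ p.support, (∀ d ∈ ij.1.support, d ∈ P) ∧ (∀ e ∈ ij.2.support, e ∈ Q)

theorem map_eval (f : A →ₐ[S] B) (p : OrdPoly S) (x y : ℕ+ → A) :
    f (p.eval x y) = p.eval (fun n => f (x n)) (fun n => f (y n)) := by
  simp [eval, Finsupp.sum, map_mono]

/-- A ring homomorphism commutes with evaluation of polynomials over `ℤ`, whatever the
(propositionally unique) `ℤ`-algebra structures are. -/
theorem map_eval_int {A B : Type*} [Ring A] [Ring B] [Algebra ℤ A] [Algebra ℤ B] (f : A →+* B)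
    (p : OrdPoly ℤ) (x y : ℕ+ → A) :
    f (p.eval x y) = p.eval (fun n => f (x n)) (fun n => f (y n)) := by
  obtain rfl : ‹Algebra ℤ A› = Ring.toIntAlgebra A := Subsingleton.elim _ _
  obtain rfl : ‹Algebra ℤ B› = Ring.toIntAlgebra B := Subsingleton.elim _ _
  simp [eval, Finsupp.sum, map_mono]

theorem IsIn.eval_congr {p : OrdPoly S} {P Q : Set ℕ+} (hp : p.IsIn P Q) {x x' y y' : ℕ+ → A}
    (hx : ∀ m ∈ P, x m = x' m) (hy : ∀ n ∈ Q, y n = y' n) : p.eval x y = p.eval x' y' := by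
  refine Finsupp.sum_congr fun ij hij => ?_
  rw [mono_congr fun n hn => hx n ((hp ij hij).1 n hn),
    mono_congr fun n hn => hy n ((hp ij hij).2 n hn)]

theorem eval_toRat [Algebra ℚ A] (p : OrdPoly ℤ) (x y : ℕ+ → A) :
    p.toRat.eval x y = p.eval x y := by
  unfold toRat eval
  rw [Finsupp.sum_mapRange_index (by simp)]
  refine Finsupp.sum_congr fun ij _ => ?_
  simp [Int.cast_smul_eq_zsmul]

theorem mono_mem_adjoin {P : Set ℕ+} (x : ℕ+ → A) {i : ℕ+ →₀ ℕ} (hi : ∀ d ∈ i.support, d ∈ P) :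
    mono x i ∈ Algebra.adjoin S (x '' P) := by
  refine Subalgebra.list_prod_mem _ fun a ha => ?_
  obtain ⟨n, hn, rfl⟩ := List.mem_map.1 ha
  have hx : x n ∈ Algebra.adjoin S (x '' P) :=
    Algebra.subset_adjoin ⟨n, hi n (by simpa using hn), rfl⟩
  exact Subalgebra.pow_mem _ hx _

theorem IsIn.eval_mem {p : OrdPoly S} {P Q : Set ℕ+} (hp : p.IsIn P Q) (x y : ℕ+ → A) :
    p.eval x y ∈ Algebra.adjoin S (x '' P ∪ y '' Q) := by
  refine Subalgebra.sum_mem _ fun ij hij => Subalgebra.smul_mem _ (Subalgebra.mul_mem _ ?_ ?_) _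
  · exact Algebra.adjoin_mono Set.subset_union_left (mono_mem_adjoin x (hp ij hij).1)
  · exact Algebra.adjoin_mono Set.subset_union_right (mono_mem_adjoin y (hp ij hij).2)

end OrdPoly

/-! ### Spans of normally ordered monomials -/

section Span

variable {S A : Type*} [CommRing S] [Ring A] [Algebra S A]

theorem mono_subtype (P : Set ℕ+) (x : ℕ+ → A) (i : P →₀ ℕ) :
    mono (fun m : P => x m) i = mono x (i.embDomain (Function.Embedding.subtype _)) :=
  mono_comp_embedding (OrderEmbedding.subtype (· ∈ P)) x i

theorem adjoin_image_eq_span_mono {P : Set ℕ+} {x : ℕ+ → A}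
    (hx : ∀ m ∈ P, ∀ n ∈ P, Commute (x m) (x n)) :
    Subalgebra.toSubmodule (Algebra.adjoin S (x '' P)) =
      Submodule.span S (Set.range (mono fun m : P => x m)) := by
  rw [← adjoin_eq_span_mono (fun m : P => x m) fun i j => hx i i.2 j j.2, Set.image_eq_range]

theorem adjoin_mul_adjoin_eq_span {P Q : Set ℕ+} {x y : ℕ+ → A}
    (hx : ∀ m ∈ P, ∀ n ∈ P, Commute (x m) (x n)) (hy : ∀ m ∈ Q, ∀ n ∈ Q, Commute (y m) (y n)) :
    Subalgebra.toSubmodule (Algebra.adjoin S (x '' P)) *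
        Subalgebra.toSubmodule (Algebra.adjoin S (y '' Q)) =
      Submodule.span S (Set.range fun ij : (P →₀ ℕ) × (Q →₀ ℕ) =>
        mono (fun m : P => x m) ij.1 * mono (fun n : Q => y n) ij.2) := by
  rw [adjoin_image_eq_span_mono hx, adjoin_image_eq_span_mono hy, Submodule.span_mul_span]
  congr 1
  ext z
  simp [Set.mem_mul]

/-- This converts normal ordering, stated as membership in a product of subalgebras, into an actual
polynomial with control of the variables that occur. -/
theorem exists_eval_eq {P Q : Set ℕ+} {x y : ℕ+ → A}
    (hx : ∀ m ∈ P, ∀ n ∈ P, Commute (x m) (x n)) (hy : ∀ m ∈ Q, ∀ n ∈ Q, Commute (y m) (y n))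
    {z : A} (hz : z ∈ Subalgebra.toSubmodule (Algebra.adjoin S (x '' P)) *
      Subalgebra.toSubmodule (Algebra.adjoin S (y '' Q))) :
    ∃ p : OrdPoly S, p.IsIn P Q ∧ z = p.eval x y := by
  rw [adjoin_mul_adjoin_eq_span hx hy] at hz
  have : z ∈ Submodule.span S
      ((fun ij : (ℕ+ →₀ ℕ) × (ℕ+ →₀ ℕ) => mono x ij.1 * mono y ij.2) ''
        {ij | (∀ d ∈ ij.1.support, d ∈ P) ∧ (∀ e ∈ ij.2.support, e ∈ Q)}) := by
    refine Submodule.span_mono ?_ hz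
    rintro _ ⟨⟨i, j⟩, rfl⟩
    refine ⟨(i.embDomain (Function.Embedding.subtype _),
      j.embDomain (Function.Embedding.subtype _)), ?_, ?_⟩
    · constructor <;> intro d hd <;>
        · rw [Finsupp.support_embDomain, Finset.mem_map] at hd
          obtain ⟨a, _, rfl⟩ := hd
          exact a.2
    · simp only [mono_subtype]
  obtain ⟨p, hp, rfl⟩ := (Finsupp.mem_span_image_iff_linearCombination S).1 this
  exact ⟨p, fun ij hij => hp hij, rfl⟩

end Span

/-! ### Ghost components -/

section Ghost

variable {A B : Type*} [Ring A] [Ring B]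

/-- The set `D*(n)` of the divisors of `n` other than `n`. -/
def properDivisors (n : ℕ+) : Set ℕ+ := {d | d ∣ n ∧ d ≠ n}

theorem lt_of_mem_properDivisors {d n : ℕ+} (h : d ∈ properDivisors n) : d < n :=
  lt_of_le_of_ne (PNat.le_of_dvd h.1) h.2

theorem isTruncationSet_properDivisors (n : ℕ+) : IsTruncationSet (properDivisors n) := by
  intro m hm d hd
  exact ⟨hd.trans hm.1, ((PNat.le_of_dvd hd).trans_lt (lt_of_mem_properDivisors hm)).ne⟩

theorem isTruncationSet_univ : IsTruncationSet Set.univ := fun _ _ _ _ => trivial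

theorem IsTruncationSet.properDivisors_subset {P : Set ℕ+} (hP : IsTruncationSet P) {n : ℕ+}
    (hn : n ∈ P) : properDivisors n ⊆ P := fun d hd => hP n hn d hd.1

/-- `w_n(x) - n x_n`, which only involves the `x_d` with `d` a proper divisor of `n`. -/
def ghostTail (x : ℕ+ → A) (n : ℕ+) : A :=
  ∑ d ∈ ((Finset.Icc 1 n).filter (fun d : ℕ+ => (d : ℕ) ∣ (n : ℕ))).erase n,
    ((d : ℕ) : A) * x d ^ ((n : ℕ) / (d : ℕ))

theorem ghost_eq (x : ℕ+ → A) (n : ℕ+) : ghost x n = ((n : ℕ) : A) * x n + ghostTail x n := by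
  unfold ghost ghostTail
  rw [← Finset.add_sum_erase _ _ (show n ∈ _ by simp), Nat.div_self n.pos, pow_one]

theorem mem_ghostTail_index {d n : ℕ+} :
    d ∈ ((Finset.Icc 1 n).filter (fun d : ℕ+ => (d : ℕ) ∣ (n : ℕ))).erase n ↔
      d ∈ properDivisors n := by
  simp only [Finset.mem_erase, Finset.mem_filter, Finset.mem_Icc, properDivisors, Set.mem_ofPred_eq,
    PNat.dvd_iff]
  constructor
  · rintro ⟨h, _, h'⟩
    exact ⟨h', h⟩
  · rintro ⟨h, h'⟩
    exact ⟨h', ⟨one_le, PNat.le_of_dvd (PNat.dvd_iff.2 h)⟩, h⟩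

theorem ghostTail_congr {x x' : ℕ+ → A} {n : ℕ+} (h : ∀ d ∈ properDivisors n, x d = x' d) :
    ghostTail x n = ghostTail x' n :=
  Finset.sum_congr rfl fun d hd => by rw [h d (mem_ghostTail_index.1 hd)]

theorem IsTruncationSet.ghost_congr {P : Set ℕ+} (hP : IsTruncationSet P) {x x' : ℕ+ → A}
    (h : ∀ d ∈ P, x d = x' d) {n : ℕ+} (hn : n ∈ P) : ghost x n = ghost x' n := by
  rw [ghost_eq, ghost_eq, h n hn,
    ghostTail_congr fun d hd => h d (hP.properDivisors_subset hn hd)]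

theorem map_ghost (f : A →+* B) (x : ℕ+ → A) (n : ℕ+) :
    f (ghost x n) = ghost (fun m => f (x m)) n := by
  simp [ghost]

section Algebra

variable {R : Type*} [CommRing R] [Algebra R A]

theorem ghostTail_mem (S : Subalgebra R A) {x : ℕ+ → A} {n : ℕ+}
    (h : ∀ d ∈ properDivisors n, x d ∈ S) : ghostTail x n ∈ S :=
  S.sum_mem fun d hd => S.mul_mem (natCast_mem S _) (S.pow_mem (h d (mem_ghostTail_index.1 hd)) _)

/-- The system `w_n = n x_n + (terms in earlier x_d)` is triangular with invertible diagonal, so it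
can be solved for the `x_n` within a truncation set. -/
theorem adjoin_ghost {P : Set ℕ+} (hP : IsTruncationSet P)
    (hu : ∀ m ∈ P, IsUnit ((m : ℕ) : R)) (x : ℕ+ → A) :
    Algebra.adjoin R (ghost x '' P) = Algebra.adjoin R (x '' P) := by
  apply le_antisymm
  · rw [Algebra.adjoin_le_iff]
    rintro _ ⟨n, hn, rfl⟩
    have h : ∀ d ∈ P, x d ∈ Algebra.adjoin R (x '' P) := fun d hd =>
      Algebra.subset_adjoin ⟨d, hd, rfl⟩
    rw [ghost_eq]
    exact Subalgebra.add_mem _ (Subalgebra.mul_mem _ (natCast_mem _ _) (h n hn))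
      (ghostTail_mem _ fun d hd => h d (hP.properDivisors_subset hn hd))
  · rw [Algebra.adjoin_le_iff]
    rintro _ ⟨n, hn, rfl⟩
    induction n using WellFoundedLT.induction with
    | ind n ih =>
      obtain ⟨u, hu⟩ := hu n hn
      have : x n = (↑u⁻¹ : R) • (ghost x n - ghostTail x n) := by
        rw [ghost_eq, add_sub_cancel_right, ← map_natCast (algebraMap R A), ← hu,
          ← Algebra.smul_def, smul_smul, Units.inv_mul, one_smul]
      rw [this]
      refine Subalgebra.smul_mem _ (Subalgebra.sub_mem _ (Algebra.subset_adjoin (Set.mem_image_of_mem _ hn))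
        (ghostTail_mem _ fun d hd => ?_)) _
      exact ih d (lt_of_mem_properDivisors hd) (hP.properDivisors_subset hn hd)

/-- Each `x_n` lies in the algebra generated by the commuting ghost components. -/
theorem commute_of_ghost_commute {P : Set ℕ+} (hP : IsTruncationSet P)
    (hu : ∀ m ∈ P, IsUnit ((m : ℕ) : R)) {x : ℕ+ → A}
    (h : ∀ m ∈ P, ∀ n ∈ P, Commute (ghost x m) (ghost x n)) :
    ∀ m ∈ P, ∀ n ∈ P, Commute (x m) (x n) := by
  intro m hm n hn
  refine commute_of_mem_adjoin (R := R) (s := ghost x '' P) ?_ ?_ ?_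
  · rintro _ ⟨m, hm, rfl⟩ _ ⟨n, hn, rfl⟩
    exact h m hm n hn
  · rw [adjoin_ghost hP hu]; exact Algebra.subset_adjoin ⟨m, hm, rfl⟩
  · rw [adjoin_ghost hP hu]; exact Algebra.subset_adjoin ⟨n, hn, rfl⟩

end Algebra

end Ghost

/-! ### Universal properties -/

/-- The relations defining `B_{P,Q}(R)` through ghost components, for families in a ring. -/
structure GhostRelations {A : Type*} [Ring A] (P Q : Set ℕ+) (x y : ℕ+ → A) : Prop where
  xx : ∀ m ∈ P, ∀ n ∈ P, Commute (ghost x m) (ghost x n)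
  yy : ∀ m ∈ Q, ∀ n ∈ Q, Commute (ghost y m) (ghost y n)
  yx : ∀ m ∈ P, ∀ n ∈ Q, ⁅ghost y n, ghost x m⁆ = if m = n then ((m : ℕ) : A) else 0

/-- The relations given by structure polynomials, for families in a ring. -/
structure StructRelations {A : Type*} [Ring A] (c : ℕ+ → ℕ+ → OrdPoly ℤ) (P Q : Set ℕ+)
    (x y : ℕ+ → A) : Prop where
  xx : ∀ m ∈ P, ∀ n ∈ P, Commute (x m) (x n)
  yy : ∀ m ∈ Q, ∀ n ∈ Q, Commute (y m) (y n)
  yx : ∀ m ∈ P, ∀ n ∈ Q, ⁅y n, x m⁆ = (c m n).eval x y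

/-- The relations defining `B'(R)`, for families in a ring. -/
structure LamRelations {A : Type*} [Ring A] (x y : ℕ+ → A) : Prop where
  xx : ∀ m n, Commute (x m) (x n)
  yy : ∀ m n, Commute (y m) (y n)
  lam : (Lam y 1 * Lam x 0 : MvPowerSeries (Fin 2) A) = Lam x 0 * Lam y 1 * geomST A

section Universal

theorem GhostRelations.map {A B : Type*} [Ring A] [Ring B] {P Q : Set ℕ+} {x y : ℕ+ → A}
    (h : GhostRelations P Q x y) (f : A →+* B) :
    GhostRelations P Q (fun m => f (x m)) (fun n => f (y n)) where
  xx m hm n hn := by rw [← map_ghost, ← map_ghost]; exact (h.xx m hm n hn).map f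
  yy m hm n hn := by rw [← map_ghost, ← map_ghost]; exact (h.yy m hm n hn).map f
  yx m hm n hn := by
    have := congrArg f (h.yx m hm n hn)
    rw [Ring.lie_def, map_sub, map_mul, map_mul, map_ghost, map_ghost] at this
    rw [Ring.lie_def, this]
    split_ifs <;> simp

theorem GhostRelations.of_injective {A B : Type*} [Ring A] [Ring B] {P Q : Set ℕ+} {x y : ℕ+ → A}
    (f : A →+* B) (hf : Function.Injective f)
    (h : GhostRelations P Q (fun m => f (x m)) (fun n => f (y n))) : GhostRelations P Q x y where
  xx m hm n hn := hf (by
    have := h.xx m hm n hn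
    rw [← map_ghost, ← map_ghost] at this
    simpa using this.eq)
  yy m hm n hn := hf (by
    have := h.yy m hm n hn
    rw [← map_ghost, ← map_ghost] at this
    simpa using this.eq)
  yx m hm n hn := hf (by
    have := h.yx m hm n hn
    rw [← map_ghost, ← map_ghost] at this
    rw [Ring.lie_def, map_sub, map_mul, map_mul, ← Ring.lie_def, this]
    split_ifs <;> simp)

theorem GhostRelations.mono {A : Type*} [Ring A] {P Q P' Q' : Set ℕ+} {x y : ℕ+ → A}
    (h : GhostRelations P Q x y) (hP : P' ⊆ P) (hQ : Q' ⊆ Q) : GhostRelations P' Q' x y where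
  xx m hm n hn := h.xx m (hP hm) n (hP hn)
  yy m hm n hn := h.yy m (hQ hm) n (hQ hn)
  yx m hm n hn := h.yx m (hP hm) n (hQ hn)

/-- Ghost components with index in a truncation set never see the values of the families outside it;
this makes the default value `0` of the generators harmless. -/
theorem GhostRelations.congr {A : Type*} [Ring A] {P Q : Set ℕ+} (hP : IsTruncationSet P)
    (hQ : IsTruncationSet Q) {x y x' y' : ℕ+ → A} (h : GhostRelations P Q x y)
    (hx : ∀ m ∈ P, x' m = x m) (hy : ∀ n ∈ Q, y' n = y n) : GhostRelations P Q x' y' where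
  xx m hm n hn := by
    rw [hP.ghost_congr hx hm, hP.ghost_congr hx hn]; exact h.xx m hm n hn
  yy m hm n hn := by
    rw [hQ.ghost_congr hy hm, hQ.ghost_congr hy hn]; exact h.yy m hm n hn
  yx m hm n hn := by
    rw [hP.ghost_congr hx hm, hQ.ghost_congr hy hn]; exact h.yx m hm n hn

variable (R : Type u) [CommRing R] (P Q : Set ℕ+) {A : Type*} [Ring A] [Algebra R A]

/-- The homomorphism from the free algebra given by two families. -/
def freeLift (x y : ℕ+ → A) : Free R P Q →ₐ[R] A :=
  FreeAlgebra.lift R (Sum.elim (fun m : P => x m) (fun n : Q => y n))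

variable {R P Q}

theorem freeLift_fx (x y : ℕ+ → A) {m : ℕ+} (hm : m ∈ P) : freeLift R P Q x y (fx R P Q m) = x m := by
  simp [freeLift, fx, hm]

theorem freeLift_fy (x y : ℕ+ → A) {n : ℕ+} (hn : n ∈ Q) : freeLift R P Q x y (fy R P Q n) = y n := by
  simp [freeLift, fy, hn]

theorem free_hom_ext {f g : Free R P Q →ₐ[R] A} (hx : ∀ m ∈ P, f (fx R P Q m) = g (fx R P Q m))
    (hy : ∀ n ∈ Q, f (fy R P Q n) = g (fy R P Q n)) : f = g := by
  refine FreeAlgebra.hom_ext (funext ?_)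
  rintro (⟨m, hm⟩ | ⟨n, hn⟩)
  · simpa [fx, hm] using hx m hm
  · simpa [fy, hn] using hy n hn

theorem adjoin_free : Algebra.adjoin R (fx R P Q '' P ∪ fy R P Q '' Q) = ⊤ := by
  rw [eq_top_iff, ← FreeAlgebra.adjoin_range_ι]
  refine Algebra.adjoin_mono ?_
  rintro _ ⟨⟨m, hm⟩ | ⟨n, hn⟩, rfl⟩
  · exact Or.inl ⟨m, hm, by simp [fx, hm]⟩
  · exact Or.inr ⟨n, hn, by simp [fy, hn]⟩

theorem adjoin_quot (r : Free R P Q → Free R P Q → Prop) :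
    Algebra.adjoin R ((fun m => RingQuot.mkAlgHom R r (fx R P Q m)) '' P ∪
      (fun n => RingQuot.mkAlgHom R r (fy R P Q n)) '' Q) = ⊤ := by
  have := congrArg (Subalgebra.map (RingQuot.mkAlgHom R r)) (adjoin_free (R := R) (P := P) (Q := Q))
  rw [AlgHom.map_adjoin, Set.image_union, Set.image_image, Set.image_image, Algebra.map_top,
    (AlgHom.range_eq_top _).2 (RingQuot.mkAlgHom_surjective R r)] at this
  exact this

/-- An algebra homomorphism out of a quotient of the free algebra. -/
theorem exists_quotLift (r : Free R P Q → Free R P Q → Prop) (x y : ℕ+ → A)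
    (h : ∀ a b, r a b → freeLift R P Q x y a = freeLift R P Q x y b) :
    ∃ f : RingQuot r →ₐ[R] A, (∀ m ∈ P, f (RingQuot.mkAlgHom R r (fx R P Q m)) = x m) ∧
      (∀ n ∈ Q, f (RingQuot.mkAlgHom R r (fy R P Q n)) = y n) := by
  refine ⟨RingQuot.liftAlgHom R ⟨freeLift R P Q x y, fun {a b} => h a b⟩, fun m hm => ?_,
    fun n hn => ?_⟩
  · rw [RingQuot.liftAlgHom_mkAlgHom_apply, freeLift_fx x y hm]
  · rw [RingQuot.liftAlgHom_mkAlgHom_apply, freeLift_fy x y hn]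

theorem quot_hom_ext {r : Free R P Q → Free R P Q → Prop} {f g : RingQuot r →ₐ[R] A}
    (hx : ∀ m ∈ P, f (RingQuot.mkAlgHom R r (fx R P Q m)) = g (RingQuot.mkAlgHom R r (fx R P Q m)))
    (hy : ∀ n ∈ Q, f (RingQuot.mkAlgHom R r (fy R P Q n)) = g (RingQuot.mkAlgHom R r (fy R P Q n))) :
    f = g :=
  RingQuot.ringQuot_ext' R f g (free_hom_ext hx hy)

theorem lie_eq_zero_iff {a b : A} : ⁅a, b⁆ = 0 ↔ Commute a b := by
  rw [Ring.lie_def, sub_eq_zero]; rfl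

theorem map_ring_lie {B : Type*} [Ring B] (f : A →+* B) (a b : A) : f ⁅a, b⁆ = ⁅f a, f b⁆ := by
  simp [Ring.lie_def]

theorem GhostB.relations : GhostRelations P Q (GhostB.x R P Q) (GhostB.y R P Q) := by
  have hx : ∀ m, ghost (GhostB.x R P Q) m =
      (RingQuot.mkAlgHom R (GhostRel R P Q)).toRingHom (ghost (fx R P Q) m) := fun m =>
    (map_ghost _ _ _).symm
  have hy : ∀ m, ghost (GhostB.y R P Q) m =
      (RingQuot.mkAlgHom R (GhostRel R P Q)).toRingHom (ghost (fy R P Q) m) := fun m =>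
    (map_ghost _ _ _).symm
  refine ⟨fun m hm n hn => ?_, fun m hm n hn => ?_, fun m hm n hn => ?_⟩
  · rw [hx, hx, ← lie_eq_zero_iff, ← map_ring_lie]
    exact (RingQuot.mkAlgHom_rel R (GhostRel.xx m n hm hn)).trans (map_zero _)
  · rw [hy, hy, ← lie_eq_zero_iff, ← map_ring_lie]
    exact (RingQuot.mkAlgHom_rel R (GhostRel.yy m n hm hn)).trans (map_zero _)
  · rw [hx, hy, ← map_ring_lie]
    refine (RingQuot.mkAlgHom_rel R (GhostRel.yx m n hm hn)).trans ?_
    split_ifs <;> simp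

theorem GhostB.exists_lift (hP : IsTruncationSet P) (hQ : IsTruncationSet Q) {x y : ℕ+ → A}
    (h : GhostRelations P Q x y) :
    ∃ f : GhostB R P Q →ₐ[R] A, (∀ m ∈ P, f (GhostB.x R P Q m) = x m) ∧
      (∀ n ∈ Q, f (GhostB.y R P Q n) = y n) := by
  refine exists_quotLift _ x y fun a b hab => ?_
  have hx : ∀ m ∈ P, (freeLift R P Q x y).toRingHom (ghost (fx R P Q) m) = ghost x m := by
    intro m hm
    rw [map_ghost]
    exact hP.ghost_congr (fun d hd => freeLift_fx x y hd) hm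
  have hy : ∀ n ∈ Q, (freeLift R P Q x y).toRingHom (ghost (fy R P Q) n) = ghost y n := by
    intro m hm
    rw [map_ghost]
    exact hQ.ghost_congr (fun d hd => freeLift_fy x y hd) hm
  change (freeLift R P Q x y).toRingHom a = (freeLift R P Q x y).toRingHom b
  induction hab with
  | xx m n hm hn =>
    rw [map_ring_lie, hx m hm, hx n hn, map_zero, lie_eq_zero_iff]
    exact h.xx m hm n hn
  | yy m n hm hn =>
    rw [map_ring_lie, hy m hm, hy n hn, map_zero, lie_eq_zero_iff]
    exact h.yy m hm n hn
  | yx m n hm hn =>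
    rw [map_ring_lie, hx m hm, hy n hn, h.yx m hm n hn]
    split_ifs <;> simp

theorem StructB.relations (c : ℕ+ → ℕ+ → OrdPoly ℤ) :
    StructRelations c P Q (StructB.x c R P Q) (StructB.y c R P Q) := by
  let f := (RingQuot.mkAlgHom R (StructRel c R P Q)).toRingHom
  refine ⟨fun m hm n hn => ?_, fun m hm n hn => ?_, fun m hm n hn => ?_⟩
  · rw [← lie_eq_zero_iff]
    exact (map_ring_lie f _ _).symm.trans
      ((RingQuot.mkAlgHom_rel R (StructRel.xx m n hm hn)).trans (map_zero _))
  · rw [← lie_eq_zero_iff]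
    exact (map_ring_lie f _ _).symm.trans
      ((RingQuot.mkAlgHom_rel R (StructRel.yy m n hm hn)).trans (map_zero _))
  · refine (map_ring_lie f _ _).symm.trans
      ((RingQuot.mkAlgHom_rel R (StructRel.yx m n hm hn)).trans ?_)
    exact OrdPoly.map_eval_int f _ _ _

/-- The support condition on `c` keeps the default value `0` of generators outside `P` and `Q` from
entering the relations. -/
theorem StructB.exists_lift {c : ℕ+ → ℕ+ → OrdPoly ℤ}
    (hc : ∀ m n, (c m n).IsIn (properDivisors m) (properDivisors n)) (hP : IsTruncationSet P)
    (hQ : IsTruncationSet Q) {x y : ℕ+ → A} (h : StructRelations c P Q x y) :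
    ∃ f : StructB c R P Q →ₐ[R] A, (∀ m ∈ P, f (StructB.x c R P Q m) = x m) ∧
      (∀ n ∈ Q, f (StructB.y c R P Q n) = y n) := by
  refine exists_quotLift _ x y fun a b hab => ?_
  change (freeLift R P Q x y).toRingHom a = (freeLift R P Q x y).toRingHom b
  have hx : ∀ m ∈ P, (freeLift R P Q x y).toRingHom (fx R P Q m) = x m := fun m hm =>
    freeLift_fx x y hm
  have hy : ∀ n ∈ Q, (freeLift R P Q x y).toRingHom (fy R P Q n) = y n := fun n hn =>
    freeLift_fy x y hn
  induction hab with
  | xx m n hm hn =>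
    rw [map_ring_lie, hx m hm, hx n hn, map_zero, lie_eq_zero_iff]
    exact h.xx m hm n hn
  | yy m n hm hn =>
    rw [map_ring_lie, hy m hm, hy n hn, map_zero, lie_eq_zero_iff]
    exact h.yy m hm n hn
  | yx m n hm hn =>
    rw [map_ring_lie, hx m hm, hy n hn, h.yx m hm n hn, OrdPoly.map_eval_int]
    exact (hc m n).eval_congr (fun d hd => (hx d (hP.properDivisors_subset hm hd)).symm)
      (fun d hd => (hy d (hQ.properDivisors_subset hn hd)).symm)

end Universal

/-! ### A Fock space representation of `B(ℚ)` -/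

section Fock

open MvPolynomial

/-- Course-of-values recursion, used to solve triangular systems in which the unknown of index `m`
depends on those of smaller index. -/
theorem exists_recursion {V : Type*} [Zero V] (F : (ℕ+ → V) → ℕ+ → V)
    (hF : ∀ m g g', (∀ d < m, g d = g' d) → F g m = F g' m) : ∃ g : ℕ+ → V, ∀ m, g m = F g m := by
  classical
  let G : ∀ m : ℕ+, (∀ d : ℕ+, d < m → V) → V :=
    fun m ih => F (fun d => if h : d < m then ih d h else 0) m
  refine ⟨WellFounded.fix wellFounded_lt G, fun m => ?_⟩
  rw [WellFounded.fix_eq]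
  exact hF m _ _ fun d hd => by simp [hd]

/-- Solve recursively `y_n = (W_n - tail) / n`. The `W_n` need not commute, so this applies to
operators. -/
theorem exists_ghost_eq {A : Type*} [Ring A] [Algebra ℚ A] (W : ℕ+ → A) :
    ∃ y : ℕ+ → A, ∀ n, ghost y n = W n := by
  obtain ⟨y, hy⟩ := exists_recursion
    (fun (g : ℕ+ → A) n => (((n : ℕ) : ℚ)⁻¹) • (W n - ghostTail g n))
    (fun m g g' h => by
      simp only [ghostTail_congr fun d hd => h d (lt_of_mem_properDivisors hd)])
  refine ⟨y, fun n => ?_⟩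
  have hn : ((n : ℕ) : ℚ) ≠ 0 := by exact_mod_cast n.ne_zero
  rw [ghost_eq, hy n, ← map_natCast (algebraMap ℚ A), ← Algebra.smul_def, smul_smul,
    mul_inv_cancel₀ hn, one_smul, sub_add_cancel]

theorem isUnit_pnat_rat (n : ℕ+) : IsUnit ((n : ℕ) : ℚ) :=
  (Nat.cast_ne_zero.2 n.ne_zero).isUnit

/-- The Fock space `ℚ[X, Y]`. -/
abbrev Fock : Type := MvPolynomial (ℕ+ ⊕ ℕ+) ℚ

/-- The variables `X_m` of the Fock space. -/
def fockX (m : ℕ+) : Fock := X (Sum.inl m)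

/-- The variables `Y_n` of the Fock space. -/
def fockY (n : ℕ+) : Fock := X (Sum.inr n)

/-- A derivation of a polynomial ring is freely prescribed on the variables. The condition at
`w_m(X)` determines `D X_m` from the values of `D` at earlier variables, after division by `m`. -/
theorem exists_fockDerivation (n : ℕ+) : ∃ D : Derivation ℚ Fock Fock,
    (∀ m, D (ghost fockX m) = if m = n then ((m : ℕ) : Fock) else 0) ∧ ∀ k, D (fockY k) = 0 := by
  let mk : (ℕ+ → Fock) → Derivation ℚ Fock Fock := fun g => mkDerivation ℚ (Sum.elim g 0)
  have hmk : ∀ g m, mk g (fockX m) = g m := fun g m => by simp [mk, fockX, mkDerivation_X]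
  let δ : ℕ+ → Fock := fun m => if m = n then ((m : ℕ) : Fock) else 0
  obtain ⟨g, hg⟩ := exists_recursion
    (fun (g : ℕ+ → Fock) m => (((m : ℕ) : ℚ)⁻¹) • (δ m - mk g (ghostTail fockX m)))
    (fun m g g' h => by
      have hmem : ghostTail fockX m ∈ Algebra.adjoin ℚ (fockX '' Set.Iio m) :=
        ghostTail_mem _ fun d hd =>
          Algebra.subset_adjoin (Set.mem_image_of_mem _ (lt_of_mem_properDivisors hd))
      have : mk g (ghostTail fockX m) = mk g' (ghostTail fockX m) := by
        refine Derivation.eqOn_adjoin ?_ hmem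
        rintro _ ⟨d, hd, rfl⟩
        rw [hmk, hmk, h d hd]
      simp only [this])
  refine ⟨mk g, fun m => ?_, fun k => ?_⟩
  · have hm : ((m : ℕ) : ℚ) ≠ 0 := by exact_mod_cast m.ne_zero
    rw [ghost_eq, ← nsmul_eq_mul, map_add, map_nsmul, hmk, hg m, ← Nat.cast_smul_eq_nsmul ℚ,
      smul_smul, mul_inv_cancel₀ hm, one_smul, sub_add_cancel]
  · simp [mk, fockY, mkDerivation_X]

/-- The derivation of the Fock space with `w_m(X) ↦ δ_{m,n} m` and `Y_k ↦ 0`. -/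
def fockD (n : ℕ+) : Derivation ℚ Fock Fock := (exists_fockDerivation n).choose

theorem fockD_ghost (n m : ℕ+) :
    fockD n (ghost fockX m) = if m = n then ((m : ℕ) : Fock) else 0 :=
  (exists_fockDerivation n).choose_spec.1 m

theorem fockD_fockY (n k : ℕ+) : fockD n (fockY k) = 0 :=
  (exists_fockDerivation n).choose_spec.2 k

theorem fockD_eq_zero {n : ℕ+} {f : Fock} (hf : f ∈ Algebra.adjoin ℚ (Set.range fockY)) :
    fockD n f = 0 := by
  have : Set.EqOn (fockD n) (0 : Derivation ℚ Fock Fock) (Set.range fockY) := by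
    rintro _ ⟨k, rfl⟩
    simpa using fockD_fockY n k
  simpa using Derivation.eqOn_adjoin this hf

theorem ghost_fockY_mem (n : ℕ+) : ghost fockY n ∈ Algebra.adjoin ℚ (Set.range fockY) := by
  rw [← Set.image_univ, ← adjoin_ghost isTruncationSet_univ fun m _ => isUnit_pnat_rat m]
  exact Algebra.subset_adjoin (Set.mem_image_of_mem _ trivial)

/-- The commutator of two derivations is a derivation. It kills every `w_k(X)`, because a derivation
maps it to a constant, and every `Y_k`; together these generate the Fock space. -/
theorem fockD_comm (m n : ℕ+) (f : Fock) : fockD m (fockD n f) = fockD n (fockD m f) := by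
  have hX : ∀ k, fockX k ∈ Algebra.adjoin ℚ (ghost fockX '' Set.univ) := fun k => by
    rw [adjoin_ghost isTruncationSet_univ fun m _ => isUnit_pnat_rat m]
    exact Algebra.subset_adjoin (Set.mem_image_of_mem _ trivial)
  have hghost : ∀ a b k, fockD a (fockD b (ghost fockX k)) = 0 := fun a b k => by
    rw [fockD_ghost]; split_ifs <;> simp
  have key : ⁅fockD m, fockD n⁆ = 0 := by
    refine MvPolynomial.derivation_ext ?_
    rintro (k | k)
    · have h0 : Set.EqOn (⁅fockD m, fockD n⁆ : Derivation ℚ Fock Fock) (0 : Derivation ℚ Fock Fock)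
          (ghost fockX '' Set.univ) := by
        rintro _ ⟨k, -, rfl⟩
        rw [Derivation.commutator_apply, hghost, hghost]
        simp
      exact Derivation.eqOn_adjoin h0 (hX k)
    · change ⁅fockD m, fockD n⁆ (fockY k) = 0
      rw [Derivation.commutator_apply, fockD_fockY, fockD_fockY]
      simp
  have := congrArg (fun D : Derivation ℚ Fock Fock => D f) key
  rw [Derivation.commutator_apply] at this
  exact sub_eq_zero.1 this

/-- The operator of the Fock space by which `w_n(y)` acts. -/
def fockW (n : ℕ+) : Module.End ℚ Fock :=
  Algebra.lmul ℚ Fock (ghost fockY n) + (fockD n : Fock →ₗ[ℚ] Fock)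

theorem fockW_apply (n : ℕ+) (f : Fock) : fockW n f = ghost fockY n * f + fockD n f := rfl

/-- The derivations commute with each other and kill `w_n(Y)`, so the operators `fockW n` commute;
by the Leibniz rule, bracketing with multiplication by `w_m(X)` leaves multiplication by its
derivative `δ_{m,n} m`. -/
theorem fockRelations {y : ℕ+ → Module.End ℚ Fock} (hy : ∀ n, ghost y n = fockW n) :
    GhostRelations Set.univ Set.univ (fun m => Algebra.lmul ℚ Fock (fockX m)) y := by
  have hx : ∀ m, ghost (fun m => Algebra.lmul ℚ Fock (fockX m)) m =
      Algebra.lmul ℚ Fock (ghost fockX m) := fun m =>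
    (map_ghost (Algebra.lmul ℚ Fock).toRingHom fockX m).symm
  refine ⟨fun m _ n _ => ?_, fun m _ n _ => ?_, fun m _ n _ => ?_⟩
  · rw [hx, hx]
    exact (Commute.all _ _).map (Algebra.lmul ℚ Fock)
  · rw [hy, hy]
    refine LinearMap.ext fun f => ?_
    simp only [Module.End.mul_apply, fockW_apply, map_add, Derivation.leibniz,
      fockD_eq_zero (ghost_fockY_mem _), fockD_comm m n, smul_eq_mul]
    ring
  · rw [hx, hy, Ring.lie_def]
    refine LinearMap.ext fun f => ?_
    rw [LinearMap.sub_apply, Module.End.mul_apply, Module.End.mul_apply, fockW_apply,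
      Algebra.coe_lmul_eq_mul, LinearMap.mul_apply', LinearMap.mul_apply', fockW_apply, Derivation.leibniz, fockD_ghost]
    split_ifs with h
    · simp [smul_eq_mul]; ring
    · simp [smul_eq_mul]; ring

/-- The operators `y_n` are known only through their ghost components. On `V = ℚ[Y]` the derivations
vanish, so `w_n(y)` acts as multiplication by `w_n(Y)`. Pairs (operator, element of `V`) in which
the operator acts on `V` as that element form a subalgebra `T`; it contains the ghost components of
the pairs `(y_n, Y_n)`, hence the pairs themselves. -/
theorem fock_mono_apply_one {y : ℕ+ → Module.End ℚ Fock} (hy : ∀ n, ghost y n = fockW n)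
    (j : ℕ+ →₀ ℕ) : mono y j 1 = mono fockY j := by
  let V := Algebra.adjoin ℚ (Set.range fockY)
  let T : Subalgebra ℚ (Module.End ℚ Fock × Fock) :=
    { carrier := {p | p.2 ∈ V ∧ ∀ f ∈ V, p.1 f = p.2 * f}
      mul_mem' := fun {a b} ha hb => ⟨V.mul_mem ha.1 hb.1, fun f hf => by
        simp only [Prod.fst_mul, Prod.snd_mul, Module.End.mul_apply]
        rw [hb.2 f hf, ha.2 _ (V.mul_mem hb.1 hf), mul_assoc]⟩
      add_mem' := fun {a b} ha hb => ⟨V.add_mem ha.1 hb.1, fun f hf => by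
        simp only [Prod.fst_add, Prod.snd_add, LinearMap.add_apply]
        rw [ha.2 f hf, hb.2 f hf, add_mul]⟩
      algebraMap_mem' := fun r => ⟨V.algebraMap_mem r, fun f _ => by
        simp [Module.algebraMap_end_apply, Algebra.smul_def]⟩ }
  let z : ℕ+ → Module.End ℚ Fock × Fock := fun n => (y n, fockY n)
  have hz1 : ∀ n, (ghost z n).1 = ghost y n := fun n => map_ghost (RingHom.fst _ _) z n
  have hz2 : ∀ n, (ghost z n).2 = ghost fockY n := fun n => map_ghost (RingHom.snd _ _) z n
  have hT : Algebra.adjoin ℚ (z '' Set.univ) ≤ T := by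
    rw [← adjoin_ghost isTruncationSet_univ fun m _ => isUnit_pnat_rat m, Algebra.adjoin_le_iff]
    rintro _ ⟨n, -, rfl⟩
    refine ⟨?_, fun f hf => ?_⟩
    · rw [hz2]; exact ghost_fockY_mem n
    · rw [hz1, hz2, hy, fockW_apply, fockD_eq_zero hf, add_zero]
  have hm : mono z j ∈ T :=
    hT (OrdPoly.mono_mem_adjoin z fun _ _ => trivial)
  have h := hm.2 1 V.one_mem
  have h1 : (mono z j).1 = mono y j := map_mono (MonoidHom.fst _ _) z j
  have h2 : (mono z j).2 = mono fockY j := map_mono (MonoidHom.snd _ _) z j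
  rwa [h1, h2, mul_one] at h

theorem fock_linearIndependent : LinearIndependent ℚ
    (fun ij : (ℕ+ →₀ ℕ) × (ℕ+ →₀ ℕ) => mono fockX ij.1 * mono fockY ij.2) := by
  have h : (fun ij : (ℕ+ →₀ ℕ) × (ℕ+ →₀ ℕ) => mono fockX ij.1 * mono fockY ij.2) =
      basisMonomials (ℕ+ ⊕ ℕ+) ℚ ∘ Finsupp.sumFinsuppEquivProdFinsupp.symm := by
    funext ij
    rw [mono_eq_prod, mono_eq_prod, Function.comp_apply, coe_basisMonomials]
    beta_reduce
    rw [monomial_eq, C_1, one_mul]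
    change _ = (Finsupp.sumElim ij.1 ij.2).prod _
    rw [Finsupp.prod_sumElim]
    rfl
  rw [h]
  exact (basisMonomials _ _).linearIndependent.comp _ (Equiv.injective _)

/-- The monomials `x^i y^j` are linearly independent in `B(ℚ)`. -/
theorem GhostB.linearIndependent : LinearIndependent ℚ
    (fun ij : (ℕ+ →₀ ℕ) × (ℕ+ →₀ ℕ) => mono (GhostB.x ℚ Set.univ Set.univ) ij.1 *
      mono (GhostB.y ℚ Set.univ Set.univ) ij.2) := by
  obtain ⟨y, hy⟩ := exists_ghost_eq fockW
  obtain ⟨f, hfx, hfy⟩ := GhostB.exists_lift (R := ℚ) isTruncationSet_univ isTruncationSet_univ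
    (fockRelations hy)
  -- Apply the operator to the vacuum vector `1`.
  let g : GhostB ℚ Set.univ Set.univ →ₗ[ℚ] Fock := (LinearMap.applyₗ (1 : Fock)).comp f.toLinearMap
  refine LinearIndependent.of_comp g ?_
  convert fock_linearIndependent using 1
  funext ij
  simp only [g, Function.comp_apply, LinearMap.comp_apply, AlgHom.toLinearMap_apply, map_mul,
    map_mono, hfx _ trivial, hfy _ trivial, LinearMap.applyₗ_apply_apply, Module.End.mul_apply]
  rw [← map_mono (Algebra.lmul ℚ Fock)]
  exact congrArg (_ * ·) (fock_mono_apply_one hy ij.2)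

end Fock

/-! ### Power series over a noncommutative ring -/

section Series

open MvPowerSeries Finset

variable {σ A B : Type*} [Ring A] [Ring B]

/-- The operator `T_v ∂/∂T_v` on power series. -/
def euler (v : σ) : MvPowerSeries σ A →+ MvPowerSeries σ A where
  toFun F := fun k => k v • coeff k F
  map_zero' := by ext k; exact smul_zero _
  map_add' F G := by ext k; exact smul_add _ _ _

theorem coeff_euler (v : σ) (F : MvPowerSeries σ A) (k : σ →₀ ℕ) :
    coeff k (euler v F) = k v • coeff k F := rfl

theorem euler_mul (v : σ) (F G : MvPowerSeries σ A) :
    euler v (F * G) = euler v F * G + F * euler v G := by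
  classical
  ext k
  rw [map_add, coeff_euler, coeff_mul, coeff_mul, coeff_mul, ← sum_add_distrib, smul_sum]
  refine sum_congr rfl fun p hp => ?_
  rw [coeff_euler, coeff_euler, ← mem_antidiagonal.1 hp, Finsupp.add_apply, add_smul,
    smul_mul_assoc, mul_smul_comm]

theorem euler_one (v : σ) : euler v (1 : MvPowerSeries σ A) = 0 := by
  classical
  ext k
  rw [coeff_euler, coeff_one]
  split_ifs with h <;> simp [h]

theorem euler_monomial (v : σ) (k : σ →₀ ℕ) (a : A) :
    euler v (monomial k a) = k v • monomial k a := by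
  classical
  ext l
  rw [coeff_euler, map_nsmul, coeff_monomial]
  split_ifs with h <;> simp [h]

/-- The power series divisible by `T_v`. -/
def VanishesAt (v : σ) (F : MvPowerSeries σ A) : Prop := ∀ k : σ →₀ ℕ, k v = 0 → coeff k F = 0

namespace VanishesAt

variable {v : σ} {F G : MvPowerSeries σ A}

theorem mul_left (h : VanishesAt v F) (G : MvPowerSeries σ A) : VanishesAt v (G * F) := by
  classical
  intro k hk
  rw [coeff_mul]
  refine sum_eq_zero fun p hp => ?_
  have := congrArg (· v) (mem_antidiagonal.1 hp)
  simp only [Finsupp.add_apply] at this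
  rw [h p.2 (by omega), mul_zero]

theorem mul_right (h : VanishesAt v F) (G : MvPowerSeries σ A) : VanishesAt v (F * G) := by
  classical
  intro k hk
  rw [coeff_mul]
  refine sum_eq_zero fun p hp => ?_
  have := congrArg (· v) (mem_antidiagonal.1 hp)
  simp only [Finsupp.add_apply] at this
  rw [h p.1 (by omega), zero_mul]

theorem sub (hF : VanishesAt v F) (hG : VanishesAt v G) : VanishesAt v (F - G) := fun k hk => by
  rw [map_sub, hF k hk, hG k hk, sub_zero]

/-- Uniqueness for the linear differential equation `T_v ∂F/∂T_v = W F`. -/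
theorem eq_zero_of_euler [IsAddTorsionFree A] {W : MvPowerSeries σ A} (hW : VanishesAt v W)
    (hF : VanishesAt v F) (hD : euler v F = W * F) : F = 0 := by
  classical
  have key : ∀ N, ∀ k : σ →₀ ℕ, k v = N → coeff k F = 0 := by
    intro N
    induction N using Nat.strong_induction_on with
    | _ N ih =>
      intro k hk
      rcases Nat.eq_zero_or_pos N with rfl | hN
      · exact hF k hk
      -- As `W` is divisible by `T_v`, the right-hand side at `k` only involves coefficients of `F`
      -- with smaller exponent of `T_v`, which vanish; torsion-freeness then removes the factor `k
      -- v`.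
      · have h := congrArg (coeff k) hD
        rw [coeff_euler, coeff_mul, sum_eq_zero, hk] at h
        · exact (nsmul_eq_zero_iff.1 h).resolve_right hN.ne'
        · intro p hp
          have hp := congrArg (· v) (mem_antidiagonal.1 hp)
          simp only [Finsupp.add_apply] at hp
          rcases Nat.eq_zero_or_pos (p.1 v) with h0 | h0
          · rw [hW _ h0, zero_mul]
          · rw [ih (p.2 v) (by omega) _ rfl, mul_zero]
  ext k
  rw [key _ k rfl, map_zero]

end VanishesAt

/-- The power series involving only the variable `T_v`. -/
def OnlyIn (v : σ) (F : MvPowerSeries σ A) : Prop :=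
  ∀ k : σ →₀ ℕ, k ≠ Finsupp.single v (k v) → coeff k F = 0

theorem eq_single_of_add_eq {k p q : σ →₀ ℕ} {v : σ} (h : p + q = k)
    (hp : p = Finsupp.single v (p v)) (hq : q = Finsupp.single v (q v)) :
    k = Finsupp.single v (k v) := by
  rw [← h, Finsupp.add_apply, Finsupp.single_add, ← hp, ← hq]

theorem OnlyIn.mul {v : σ} {F G : MvPowerSeries σ A} (hF : OnlyIn v F) (hG : OnlyIn v G) :
    OnlyIn v (F * G) := by
  classical
  intro k hk
  rw [coeff_mul]
  refine sum_eq_zero fun p hp => ?_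
  by_cases h1 : p.1 = Finsupp.single v (p.1 v)
  · by_cases h2 : p.2 = Finsupp.single v (p.2 v)
    · exact absurd (eq_single_of_add_eq (mem_antidiagonal.1 hp) h1 h2) hk
    · rw [hG _ h2, mul_zero]
  · rw [hF _ h1, zero_mul]

theorem OnlyIn.one {v : σ} : OnlyIn v (1 : MvPowerSeries σ A) := by
  classical
  intro k hk
  rw [coeff_one, if_neg]
  rintro rfl
  simp at hk

theorem OnlyIn.euler_eq_zero {v w : σ} (hvw : v ≠ w) {F : MvPowerSeries σ A} (hF : OnlyIn v F) :
    euler w F = 0 := by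
  ext k
  rw [coeff_euler, map_zero]
  by_cases h : k = Finsupp.single v (k v)
  · rw [h, Finsupp.single_eq_of_ne hvw.symm, zero_smul]
  · rw [hF k h, smul_zero]

theorem coeff_mul_of_onlyIn {v w : Fin 2} (hvw : v ≠ w) {F G : MvPowerSeries (Fin 2) A}
    (hF : OnlyIn v F) (hG : OnlyIn w G) (k : Fin 2 →₀ ℕ) :
    coeff k (F * G) =
      coeff (Finsupp.single v (k v)) F * coeff (Finsupp.single w (k w)) G := by
  classical
  have hk : Finsupp.single v (k v) + Finsupp.single w (k w) = k := by
    ext i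
    have hi : i = v ∨ i = w := by omega
    rcases hi with rfl | rfl
    · simp [Finsupp.single_eq_of_ne hvw]
    · simp [Finsupp.single_eq_of_ne hvw.symm]
  rw [coeff_mul, sum_eq_single_of_mem
    (Finsupp.single v (k v), Finsupp.single w (k w)) (mem_antidiagonal.2 hk)]
  rintro ⟨p, q⟩ hpq hne
  rw [HasAntidiagonal.mem_antidiagonal] at hpq
  dsimp only at hpq ⊢
  by_cases h1 : p = Finsupp.single v (p v)
  · by_cases h2 : q = Finsupp.single w (q w)
    · refine absurd ?_ hne
      have e1 : k v = p v := by
        rw [← hpq, h2, Finsupp.add_apply, Finsupp.single_eq_of_ne hvw, add_zero]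
      have e2 : k w = q w := by
        rw [← hpq, h1, Finsupp.add_apply, Finsupp.single_eq_of_ne hvw.symm, zero_add]
      rw [e1, e2, ← h1, ← h2]
    · rw [hG _ h2, mul_zero]
  · rw [hF _ h1, zero_mul]

/-! ### Geometric series -/

section Geom

/-- The inverse of `1 - U` for a power series `U` without constant term. -/
def geom (U : MvPowerSeries σ A) : MvPowerSeries σ A := invOfUnit (1 - U) 1

variable {U : MvPowerSeries σ A} (hU : constantCoeff U = 0)

include hU

theorem one_sub_mul_geom : (1 - U) * geom U = 1 := mul_invOfUnit _ _ (by simp [hU])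

theorem geom_mul_one_sub : geom U * (1 - U) = 1 := invOfUnit_mul _ _ (by simp [hU])

theorem geom_eq_of_mul {T : MvPowerSeries σ A} (h : (1 - U) * T = 1) : geom U = T := by
  rw [← mul_one (geom U), ← h, ← mul_assoc, geom_mul_one_sub hU, one_mul]

theorem geom_eq_one_add : geom U = 1 + U * geom U := by
  have := one_sub_mul_geom hU
  rw [sub_mul, one_mul] at this
  rw [← this, sub_add_cancel]

theorem geom_eq_one_add' : geom U = 1 + geom U * U := by
  have := geom_mul_one_sub hU
  rw [mul_sub, mul_one] at this
  rw [← this, sub_add_cancel]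

theorem commute_geom {F : MvPowerSeries σ A} (h : Commute F U) : Commute F (geom U) := by
  let u : (MvPowerSeries σ A)ˣ := ⟨1 - U, geom U, one_sub_mul_geom hU, geom_mul_one_sub hU⟩
  have : Commute F (u : MvPowerSeries σ A) := (Commute.one_right F).sub_right h
  exact this.units_inv_right

/-- Differentiate `(1 - U) * geom U = 1`; without commutativity the derivative of `U` stays between
two inverses. -/
theorem euler_geom (v : σ) : euler v (geom U) = geom U * euler v U * geom U := by
  have h := congrArg (euler v) (one_sub_mul_geom hU)
  rw [euler_mul, map_sub, euler_one, zero_sub] at h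
  have h2 : (1 - U) * euler v (geom U) = euler v U * geom U := by
    rw [← sub_eq_zero, ← h]; noncomm_ring
  rw [mul_assoc, ← h2, ← mul_assoc, geom_mul_one_sub hU, one_mul]

theorem map_geom (f : A →+* B) : map f (geom U) = geom (map f U) := by
  refine (geom_eq_of_mul (by rw [constantCoeff_map, hU, map_zero]) ?_).symm
  rw [← map_one (map f), ← map_sub, ← map_mul, one_sub_mul_geom hU]

end Geom

/-! ### The series `Λ` -/

section Factor

/-- The term `x_n T_v^n` (with the index shifted by one). -/
def lamTerm (x : ℕ+ → A) (v : σ) (n : ℕ) : MvPowerSeries σ A :=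
  monomial (Finsupp.single v (n + 1)) (x n.succPNat)

variable (x : ℕ+ → A) (v : σ)

theorem constantCoeff_lamTerm (n : ℕ) : constantCoeff (lamTerm x v n) = 0 := by
  classical
  rw [← coeff_zero_eq_constantCoeff_apply, lamTerm, coeff_monomial, if_neg]
  intro h
  have := congrArg (· v) h
  simp at this

theorem coeff_geom_lamTerm [DecidableEq σ] (n : ℕ) (k : σ →₀ ℕ) :
    coeff k (geom (lamTerm x v n)) =
      if k = Finsupp.single v (k v) ∧ n + 1 ∣ k v then x n.succPNat ^ (k v / (n + 1)) else 0 := by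
  let T : MvPowerSeries σ A := fun k =>
    if k = Finsupp.single v (k v) ∧ n + 1 ∣ k v then x n.succPNat ^ (k v / (n + 1)) else 0
  have hT : ∀ k, coeff k T =
    if k = Finsupp.single v (k v) ∧ n + 1 ∣ k v then x n.succPNat ^ (k v / (n + 1)) else 0 :=
    fun k => rfl
  -- By uniqueness of the inverse it suffices to check that the closed form `T` is inverse to `1 -
  -- U`.
  rw [geom_eq_of_mul (constantCoeff_lamTerm x v n) (T := T), hT]
  ext k
  rw [sub_mul, one_mul, map_sub, lamTerm, coeff_monomial_mul, coeff_one]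
  by_cases hk : n + 1 ≤ k v
  · have hle : Finsupp.single v (n + 1) ≤ k := Finsupp.single_le_iff.2 hk
    rw [if_pos hle, if_neg (by rintro rfl; simp at hk)]
    obtain ⟨l, rfl⟩ := le_iff_exists_add.1 hle
    rw [add_tsub_cancel_left, hT, hT]
    have e : (Finsupp.single v (n + 1) + l) v = (n + 1) + l v := by simp
    have e1 : (Finsupp.single v (n + 1) + l = Finsupp.single v (n + 1 + l v)) ↔
        l = Finsupp.single v (l v) := by
      rw [Finsupp.single_add v (n + 1) (l v), add_right_inj]
    have e2 : n + 1 ∣ n + 1 + l v ↔ n + 1 ∣ l v := Nat.dvd_add_right dvd_rfl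
    simp only [e, e1, e2]
    rw [Nat.add_div_left _ n.succ_pos, pow_succ']
    split_ifs <;> simp
  · rw [if_neg (by rwa [Finsupp.single_le_iff]), sub_zero, hT]
    by_cases h0 : k = 0
    · subst h0; simp
    · rw [if_neg h0, if_neg]
      rintro ⟨h1, h2⟩
      have : k v = 0 := Nat.eq_zero_of_dvd_of_lt h2 (by omega)
      rw [this, Finsupp.single_zero] at h1
      exact h0 h1

theorem onlyIn_geom_lamTerm (n : ℕ) : OnlyIn v (geom (lamTerm x v n)) := by
  classical
  intro k hk
  rw [coeff_geom_lamTerm, if_neg fun h => hk h.1]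

/-- The product of the first `N` factors of `Λ`. -/
def lamProd (N : ℕ) : MvPowerSeries σ A :=
  ((List.range N).map fun n => geom (lamTerm x v n)).prod

theorem coeff_Lam (k : σ →₀ ℕ) : coeff k (Lam x v) = coeff k (lamProd x v (k v)) := rfl

theorem lamProd_zero : lamProd x v 0 = 1 := rfl

theorem lamProd_succ (N : ℕ) : lamProd x v (N + 1) = lamProd x v N * geom (lamTerm x v N) := by
  simp [lamProd, List.range_succ]

theorem onlyIn_lamProd (N : ℕ) : OnlyIn v (lamProd x v N) := by
  induction N with
  | zero => exact OnlyIn.one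
  | succ N ih => rw [lamProd_succ]; exact ih.mul (onlyIn_geom_lamTerm x v N)

theorem onlyIn_Lam : OnlyIn v (Lam x v) := fun k hk => onlyIn_lamProd x v _ k hk

theorem coeff_lamProd_succ (N : ℕ) (k : σ →₀ ℕ) : coeff k (lamProd x v (N + 1)) =
    coeff k (lamProd x v N) + if Finsupp.single v (N + 1) ≤ k then
      coeff (k - Finsupp.single v (N + 1)) (lamProd x v (N + 1)) * x N.succPNat else 0 := by
  classical
  conv_lhs => rw [lamProd_succ, geom_eq_one_add' (constantCoeff_lamTerm x v N), mul_add, mul_one,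
    ← mul_assoc, ← lamProd_succ, map_add, lamTerm, coeff_mul_monomial]

/-- Further factors only change coefficients of higher exponent, so any sufficiently long partial
product computes `Lam`. -/
theorem coeff_lamProd_of_le {N : ℕ} {k : σ →₀ ℕ} (h : k v ≤ N) :
    coeff k (lamProd x v N) = coeff k (Lam x v) := by
  induction N, h using Nat.le_induction with
  | base => rw [coeff_Lam]
  | succ N hN ih =>
    rw [coeff_lamProd_succ, if_neg, add_zero, ih]
    intro h
    have := h v
    rw [Finsupp.single_eq_same] at this
    omega

theorem vanishesAt_Lam_sub_one : VanishesAt v (Lam x v - 1) := by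
  intro k hk
  rw [map_sub, coeff_Lam, hk, lamProd_zero, sub_self]

theorem map_Lam (f : A →+* B) : map f (Lam x v) = Lam (fun n => f (x n)) v := by
  have : ∀ N, map f (lamProd x v N) = lamProd (fun n => f (x n)) v N := by
    intro N
    induction N with
    | zero => simp [lamProd_zero]
    | succ N ih =>
      rw [lamProd_succ, lamProd_succ, map_mul, ih, map_geom (constantCoeff_lamTerm x v N)]
      simp [lamTerm]
  ext k
  rw [coeff_map, coeff_Lam, coeff_Lam, ← this, coeff_map]

/-- The series `∑ w_n(x) T_v^n`. -/
def ghostSeries : MvPowerSeries σ A := by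
  classical
  exact fun k => if h : k = Finsupp.single v (k v) ∧ 0 < k v then ghost x ⟨k v, h.2⟩ else 0

theorem coeff_ghostSeries_single (n : ℕ+) :
    coeff (Finsupp.single v (n : ℕ)) (ghostSeries x v) = ghost x n := by
  have h : (Finsupp.single v (n : ℕ) = Finsupp.single v ((Finsupp.single v (n : ℕ)) v)) ∧
      0 < (Finsupp.single v (n : ℕ)) v := by simp
  refine (dif_pos h).trans ?_
  congr 1
  exact PNat.eq (by simp)

theorem onlyIn_ghostSeries : OnlyIn v (ghostSeries x v) := fun _ hk => dif_neg fun h => hk h.1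

theorem vanishesAt_ghostSeries : VanishesAt v (ghostSeries x v) := fun k hk =>
  dif_neg fun h => by omega

/-- The series `n ∑_{r ≥ 1} x_n^r T^{nr}`, summed over `n`, have `∑_{d ∣ m} d x_d^{m/d} = w_m(x)` at
`T^m`. The index `n` in the code stands for `n + 1`. -/
theorem coeff_sum_lamTerm {N : ℕ} {k : σ →₀ ℕ} (hk : k v ≤ N) :
    coeff k (∑ n ∈ range N, (n + 1) • (lamTerm x v n * geom (lamTerm x v n))) =
      coeff k (ghostSeries x v) := by
  classical
  have e : ∀ n, lamTerm x v n * geom (lamTerm x v n) = geom (lamTerm x v n) - 1 := fun n => by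
    conv_rhs => rw [geom_eq_one_add (constantCoeff_lamTerm x v n), add_sub_cancel_left]
  simp only [e, map_sum, map_nsmul, map_sub, coeff_geom_lamTerm, coeff_one]
  by_cases h1 : k = Finsupp.single v (k v)
  · rcases Nat.eq_zero_or_pos (k v) with h0 | h0
    · have hk0 : k = 0 := by rw [h1, h0, Finsupp.single_zero]
      rw [vanishesAt_ghostSeries x v k h0]
      simp [hk0]
    · obtain ⟨m, hm⟩ : ∃ m : ℕ+, k v = m := ⟨⟨k v, h0⟩, rfl⟩
      have hk0 : k ≠ 0 := by rintro rfl; simp at h0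
      rw [hm] at h1 hk
      rw [hm]
      simp only [hk0, if_false, sub_zero]
      rw [h1, coeff_ghostSeries_single]
      simp only [true_and, smul_ite, smul_zero]
      rw [← sum_filter, ghost]
      refine sum_bij' (fun n _ => n.succPNat) (fun d _ => PNat.natPred d) ?_ ?_ ?_ ?_ ?_
      · intro n hn
        simp only [mem_filter, mem_range, mem_Icc, Nat.succPNat_coe] at hn ⊢
        exact ⟨⟨one_le, PNat.coe_le_coe _ _ |>.1 (Nat.le_of_dvd m.pos hn.2)⟩, hn.2⟩
      · intro d hd
        simp only [mem_filter, mem_range, mem_Icc] at hd ⊢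
        rw [PNat.natPred_add_one]
        refine ⟨?_, hd.2⟩
        have := Nat.le_of_dvd m.pos hd.2
        have := PNat.natPred_add_one d
        omega
      · intro n _
        exact Nat.natPred_succPNat n
      · intro d _
        exact PNat.succPNat_natPred d
      · intro n _
        simp [nsmul_eq_mul]
  · rw [onlyIn_ghostSeries x v k h1]
    refine sum_eq_zero fun n _ => ?_
    rw [if_neg fun h => h1 h.1, if_neg, sub_zero, smul_zero]
    rintro rfl
    simp at h1

variable {x}

theorem commute_lamTerm (hx : ∀ m n, Commute (x m) (x n)) (m n : ℕ) :
    Commute (lamTerm x v m) (lamTerm x v n) := by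
  change _ * _ = _ * _
  rw [lamTerm, lamTerm, monomial_mul_monomial, monomial_mul_monomial, add_comm, (hx _ _).eq]

/-- The logarithmic derivative of `Λ`. -/
theorem euler_Lam (hx : ∀ m n, Commute (x m) (x n)) :
    euler v (Lam x v) = ghostSeries x v * Lam x v := by
  classical
  have hc : ∀ m n, Commute (lamTerm x v m) (geom (lamTerm x v n)) := fun m n =>
    commute_geom (constantCoeff_lamTerm x v n) (commute_lamTerm v hx m n)
  have hcc : ∀ m n, Commute (geom (lamTerm x v m)) (geom (lamTerm x v n)) := fun m n =>
    commute_geom (constantCoeff_lamTerm x v n) (hc n m).symm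
  have hP : ∀ m N, Commute (lamTerm x v m * geom (lamTerm x v m)) (lamProd x v N) := by
    intro m N
    induction N with
    | zero => exact Commute.one_right _
    | succ N ih =>
      rw [lamProd_succ]
      exact ih.mul_right ((hc m N).mul_left (hcc m N))
  -- The logarithmic derivative of a product of commuting factors is the sum of theirs.
  have hD : ∀ N, euler v (lamProd x v N) =
      (∑ n ∈ range N, (n + 1) • (lamTerm x v n * geom (lamTerm x v n))) * lamProd x v N := by
    intro N
    induction N with
    | zero => simp [lamProd_zero, euler_one]
    | succ N ih =>
      have e : euler v (lamTerm x v N) = (N + 1) • lamTerm x v N := by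
        rw [lamTerm, euler_monomial, Finsupp.single_eq_same]
      rw [lamProd_succ, euler_mul, ih, euler_geom (constantCoeff_lamTerm x v N), e,
        sum_range_succ, add_mul, mul_assoc, mul_smul_comm, smul_mul_assoc, mul_smul_comm,
        smul_mul_assoc]
      congr 2
      rw [← mul_assoc (lamTerm x v N * _), (hP N N).eq, (hc N N).eq]
      simp only [mul_assoc]
  ext k
  rw [coeff_euler, coeff_Lam, ← coeff_euler, hD, coeff_mul, coeff_mul]
  refine sum_congr rfl fun p hp => ?_
  have hp := congrArg (· v) (mem_antidiagonal.1 hp)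
  simp only [Finsupp.add_apply] at hp
  rw [coeff_sum_lamTerm x v (by omega), coeff_lamProd_of_le x v (by omega)]

variable {R : Type*} [CommRing R] [Algebra R A] (S : Subalgebra R A)

theorem coeff_lamProd_mem {N : ℕ} (h : ∀ n < N, x n.succPNat ∈ S) (k : σ →₀ ℕ) :
    coeff k (lamProd x v N) ∈ S := by
  classical
  induction N generalizing k with
  | zero =>
    rw [lamProd_zero, coeff_one]
    split_ifs
    exacts [S.one_mem, S.zero_mem]
  | succ N ih =>
    rw [lamProd_succ, coeff_mul]
    refine S.sum_mem fun p _ => S.mul_mem (ih (fun n hn => h n (by omega)) _) ?_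
    rw [coeff_geom_lamTerm]
    split_ifs
    exacts [S.pow_mem (h N (by omega)) _, S.zero_mem]

/-- The coefficient of degree `N + 1` is `x_{N+1}` plus a polynomial in earlier variables: a
triangular system with diagonal `1`. -/
theorem coeff_Lam_single_succ (N : ℕ) : coeff (Finsupp.single v (N + 1)) (Lam x v) =
    coeff (Finsupp.single v (N + 1)) (lamProd x v N) + x N.succPNat := by
  classical
  have h0 : ∀ M, coeff (0 : σ →₀ ℕ) (lamProd x v M) = 1 := fun M => by
    rw [coeff_lamProd_of_le x v (by simp), coeff_Lam, Finsupp.zero_apply, lamProd_zero, coeff_zero_one]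
  rw [coeff_Lam, Finsupp.single_eq_same, coeff_lamProd_succ, if_pos le_rfl, tsub_self, h0, one_mul]

variable (x) in
theorem adjoin_coeff_Lam :
    Algebra.adjoin R (Set.range fun n : ℕ => coeff (Finsupp.single v n) (Lam x v)) =
      Algebra.adjoin R (Set.range x) := by
  apply le_antisymm
  · rw [Algebra.adjoin_le_iff]
    rintro _ ⟨n, rfl⟩
    exact coeff_lamProd_mem v _ (fun n _ => Algebra.subset_adjoin (Set.mem_range_self _)) _
  · rw [Algebra.adjoin_le_iff]
    -- In contrast to ghost components, solving for the variables needs no division, so this works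
    -- over every `R`.
    have key : ∀ n : ℕ, x n.succPNat ∈
        Algebra.adjoin R (Set.range fun n : ℕ => coeff (Finsupp.single v n) (Lam x v)) := by
      intro n
      induction n using Nat.strong_induction_on with
      | _ n ih =>
        rw [← add_sub_cancel_left (coeff (Finsupp.single v (n + 1)) (lamProd x v n))
          (x n.succPNat), ← coeff_Lam_single_succ]
        exact Subalgebra.sub_mem _ (Algebra.subset_adjoin (Set.mem_range_self (n + 1))) (coeff_lamProd_mem v _ ih _)
    rintro _ ⟨n, rfl⟩
    rw [← PNat.succPNat_natPred n]
    exact key _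

end Factor

end Series

/-! ### The relations between the series `Λ(x; s)` and `Λ(y; t)` -/

section LamRelation

open MvPowerSeries

variable {A B : Type*} [Ring A] [Ring B]

theorem X_zero_mul_X_one : (X 0 * X 1 : MvPowerSeries (Fin 2) A) =
    monomial (Finsupp.single 0 1 + Finsupp.single 1 1) 1 := by
  rw [X_def, X_def, monomial_mul_monomial, one_mul]

theorem constantCoeff_X_mul_X : constantCoeff (X 0 * X 1 : MvPowerSeries (Fin 2) A) = 0 := by
  simp

theorem geomST_eq_geom : geomST A = geom (X 0 * X 1) := rfl

theorem commute_X_mul_X (F : MvPowerSeries (Fin 2) A) : Commute F (X 0 * X 1) :=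
  (commute_X F 0).mul_right (commute_X F 1)

theorem commute_geomST (F : MvPowerSeries (Fin 2) A) : Commute F (geomST A) :=
  commute_geom constantCoeff_X_mul_X (commute_X_mul_X F)

theorem single_add_single_le {k : Fin 2 →₀ ℕ} :
    Finsupp.single 0 1 + Finsupp.single 1 1 ≤ k ↔ 1 ≤ k 0 ∧ 1 ≤ k 1 := by
  constructor
  · intro h
    exact ⟨by simpa using h 0, by simpa using h 1⟩
  · rintro ⟨h0, h1⟩ i
    fin_cases i
    · simpa using h0
    · simpa using h1

theorem coeff_geomST (k : Fin 2 →₀ ℕ) : coeff k (geomST A) = if k 0 = k 1 then 1 else 0 := by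
  let T : MvPowerSeries (Fin 2) A := fun k => if k 0 = k 1 then 1 else 0
  have hT : ∀ k, coeff k T = if k 0 = k 1 then 1 else 0 := fun k => rfl
  rw [geomST_eq_geom, geom_eq_of_mul constantCoeff_X_mul_X (T := T), hT]
  ext k
  rw [sub_mul, one_mul, map_sub, X_zero_mul_X_one, coeff_monomial_mul, coeff_one, hT]
  simp only [single_add_single_le, hT]
  by_cases hk : 1 ≤ k 0 ∧ 1 ≤ k 1
  · have hk0 : k ≠ 0 := by rintro rfl; simp at hk
    have e : (k - (Finsupp.single 0 1 + Finsupp.single 1 1) : Fin 2 →₀ ℕ) 0 =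
        (k - (Finsupp.single 0 1 + Finsupp.single 1 1) : Fin 2 →₀ ℕ) 1 ↔ k 0 = k 1 := by
      simp only [Finsupp.tsub_apply, Finsupp.add_apply, Finsupp.single_apply]
      simp
      omega
    simp only [e, hk, hk0, if_false, and_self, if_true, one_mul, sub_self]
  · rw [if_neg hk, sub_zero]
    by_cases h : k 0 = k 1
    · have : k = 0 := by
        ext i
        fin_cases i <;> simp <;> omega
      simp [this]
    · rw [if_neg h, if_neg]
      rintro rfl
      simp at h

theorem geomST_sub_one : geomST A - 1 = X 0 * X 1 * geomST A := by
  have := geom_eq_one_add (U := (X 0 * X 1 : MvPowerSeries (Fin 2) A)) constantCoeff_X_mul_X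
  rw [← geomST_eq_geom] at this
  rw [sub_eq_iff_eq_add, add_comm]
  exact this

theorem vanishesAt_geomST_sub_one (v : Fin 2) : VanishesAt v (geomST A - 1) := by
  have h : VanishesAt v (X v : MvPowerSeries (Fin 2) A) := by
    intro k hk
    rw [coeff_X, if_neg]
    rintro rfl
    simp at hk
  rw [geomST_sub_one]
  fin_cases v
  · exact (h.mul_right _).mul_right _
  · exact (h.mul_left _).mul_right _

theorem euler_geomST (v : Fin 2) : euler v (geomST A) = (geomST A - 1) * geomST A := by
  have e : euler v (X 0 * X 1 : MvPowerSeries (Fin 2) A) = X 0 * X 1 := by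
    rw [X_zero_mul_X_one, euler_monomial]
    fin_cases v <;> simp
  rw [geomST_eq_geom, euler_geom constantCoeff_X_mul_X, e, ← geomST_eq_geom, geomST_sub_one,
    (commute_X_mul_X (geomST A)).eq]

theorem map_geomST (f : A →+* B) : map f (geomST A) = geomST B := by
  rw [geomST_eq_geom, map_geom constantCoeff_X_mul_X]
  simp [geomST_eq_geom]

variable {x y : ℕ+ → A}

/-- At `s^m t^n` this is `[w_n(y), w_m(x)] = δ_{m,n} m`, because applying `s ∂/∂s` to `(1 - st)⁻¹`
gives `∑ m (st)^m`. -/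
theorem ghostSeries_commutator (h : GhostRelations Set.univ Set.univ x y) :
    (ghostSeries y 1 * ghostSeries x 0 : MvPowerSeries (Fin 2) A) =
      ghostSeries x 0 * ghostSeries y 1 + euler 0 (geomST A) := by
  ext k
  rw [map_add, coeff_mul_of_onlyIn (by decide) (onlyIn_ghostSeries y 1) (onlyIn_ghostSeries x 0),
    coeff_mul_of_onlyIn (by decide) (onlyIn_ghostSeries x 0) (onlyIn_ghostSeries y 1),
    coeff_euler, coeff_geomST]
  rcases Nat.eq_zero_or_pos (k 0) with h0 | h0
  · rw [vanishesAt_ghostSeries x 0 _ (by simpa using h0)]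
    simp [h0]
  rcases Nat.eq_zero_or_pos (k 1) with h1 | h1
  · rw [vanishesAt_ghostSeries y 1 _ (by simpa using h1)]
    simp [h1, h0.ne']
  obtain ⟨m, hm⟩ : ∃ m : ℕ+, k 0 = m := ⟨⟨k 0, h0⟩, rfl⟩
  obtain ⟨n, hn⟩ : ∃ n : ℕ+, k 1 = n := ⟨⟨k 1, h1⟩, rfl⟩
  rw [hm, hn, coeff_ghostSeries_single, coeff_ghostSeries_single, ← sub_eq_iff_eq_add',
    ← Ring.lie_def, h.yx m trivial n trivial]
  simp [PNat.coe_inj]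

variable [IsAddTorsionFree A]

/-- With `V`, `L`, `W`, `S` as set in the proof, `F = VL - LV - L(S - 1)` vanishes at `s = 0` and
satisfies `s ∂F/∂s = W F`, by the commutator of `V` and `W`; hence `F = 0`. -/
theorem ghostSeries_mul_Lam (hx : ∀ m n, Commute (x m) (x n))
    (h : GhostRelations Set.univ Set.univ x y) :
    (ghostSeries y 1 * Lam x 0 : MvPowerSeries (Fin 2) A) =
      Lam x 0 * ghostSeries y 1 + Lam x 0 * (geomST A - 1) := by
  set S := geomST A
  set L : MvPowerSeries (Fin 2) A := Lam x 0
  set W : MvPowerSeries (Fin 2) A := ghostSeries x 0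
  set V : MvPowerSeries (Fin 2) A := ghostSeries y 1
  have hDS : euler 0 S * L = L * euler 0 S := by
    rw [euler_geomST]
    have h1 : Commute L S := commute_geomST L
    exact (((h1.sub_right (Commute.one_right L)).mul_right h1).eq).symm
  have hL : VanishesAt 0 (L - 1) := vanishesAt_Lam_sub_one x 0
  have key : V * L - L * V - L * (S - 1) = 0 := by
    refine VanishesAt.eq_zero_of_euler (v := 0) (W := W) (vanishesAt_ghostSeries x 0) ?_ ?_
    · have e : V * L - L * V - L * (S - 1) = V * (L - 1) - (L - 1) * V - L * (S - 1) := by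
        noncomm_ring
      rw [e]
      exact ((hL.mul_left V).sub (hL.mul_right V)).sub
        ((vanishesAt_geomST_sub_one 0).mul_left L)
    · have eL : euler 0 L = W * L := euler_Lam 0 hx
      have eV : euler 0 V = 0 := (onlyIn_ghostSeries y 1).euler_eq_zero (by decide)
      have c : V * W = W * V + euler 0 S := ghostSeries_commutator h
      rw [map_sub, map_sub, euler_mul, euler_mul, euler_mul, map_sub, euler_one, eL, eV, zero_mul,
        zero_add, mul_zero, add_zero, sub_zero, ← mul_assoc, c, add_mul, hDS]
      noncomm_ring
  rw [sub_sub, sub_eq_zero] at key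
  exact key

/-- The same argument in the variable `t`: with `K = Λ(y;t)`, the difference `KL - LKS` vanishes at
`t = 0` and satisfies `t ∂F/∂t = V F`, by `ghostSeries_mul_Lam`. -/
theorem GhostRelations.lamRelations (hx : ∀ m n, Commute (x m) (x n))
    (hy : ∀ m n, Commute (y m) (y n)) (h : GhostRelations Set.univ Set.univ x y) :
    LamRelations x y := by
  refine ⟨hx, hy, ?_⟩
  have c := ghostSeries_mul_Lam hx h
  have eK : euler 1 (Lam y 1 : MvPowerSeries (Fin 2) A) = ghostSeries y 1 * Lam y 1 :=
    euler_Lam 1 hy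
  have eL : euler 1 (Lam x 0 : MvPowerSeries (Fin 2) A) = 0 :=
    (onlyIn_Lam x 0).euler_eq_zero (by decide)
  have hK : VanishesAt 1 (Lam y 1 - 1 : MvPowerSeries (Fin 2) A) := vanishesAt_Lam_sub_one y 1
  have hV : VanishesAt 1 (ghostSeries y 1 : MvPowerSeries (Fin 2) A) := vanishesAt_ghostSeries y 1
  have eS := euler_geomST (A := A) 1
  have hS := vanishesAt_geomST_sub_one (A := A) 1
  have hKS : Commute (Lam y 1) (geomST A - 1) :=
    (commute_geomST _).sub_right (Commute.one_right _)
  generalize geomST A = S at *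
  generalize (Lam x 0 : MvPowerSeries (Fin 2) A) = L at *
  generalize (Lam y 1 : MvPowerSeries (Fin 2) A) = K at *
  generalize (ghostSeries y 1 : MvPowerSeries (Fin 2) A) = V at *
  have key : K * L - L * K * S = 0 := by
    refine VanishesAt.eq_zero_of_euler (v := 1) (W := V) hV ?_ ?_
    · have e : K * L - L * K * S = (K - 1) * L - L * (K - 1) * S - L * (S - 1) := by
        noncomm_ring
      rw [e]
      exact ((hK.mul_right L).sub ((hK.mul_left L).mul_right S)).sub (hS.mul_left L)
    · rw [map_sub, euler_mul, euler_mul, euler_mul, eK, eL, eS, mul_zero, add_zero, zero_mul,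
        zero_add, mul_sub]
      have e1 : V * (L * K * S) = L * V * K * S + L * (S - 1) * K * S := by
        rw [← mul_assoc, ← mul_assoc, c]
        noncomm_ring
      have e2 : L * K * ((S - 1) * S) = L * (S - 1) * K * S := by
        rw [mul_assoc L (S - 1) K, ← hKS.eq]
        simp only [mul_assoc]
      rw [e1, e2]
      simp only [mul_assoc]
  exact sub_eq_zero.1 key

end LamRelation

/-! ### The algebra `B'(R)`: universal property and normal ordering -/

section LamB

open MvPowerSeries

variable {A B : Type*} [Ring A] [Ring B]

/-- Multiply the `Λ`-relation by `1 - st` and compare coefficients at `s^{m+1} t^{n+1}`. -/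
theorem LamRelations.coeff_commutator {x y : ℕ+ → A} (h : LamRelations x y) (m n : ℕ) :
    coeff (Finsupp.single (1 : Fin 2) (n + 1)) (Lam y 1) *
        coeff (Finsupp.single (0 : Fin 2) (m + 1)) (Lam x 0) -
      coeff (Finsupp.single (0 : Fin 2) (m + 1)) (Lam x 0) *
        coeff (Finsupp.single (1 : Fin 2) (n + 1)) (Lam y 1) =
      coeff (Finsupp.single (1 : Fin 2) n) (Lam y 1) *
        coeff (Finsupp.single (0 : Fin 2) m) (Lam x 0) := by
  have h1 : (Lam y 1 * Lam x 0 * (1 - X 0 * X 1) : MvPowerSeries (Fin 2) A) =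
      Lam x 0 * Lam y 1 := by
    rw [h.lam, mul_assoc, geomST_eq_geom, geom_mul_one_sub constantCoeff_X_mul_X, mul_one]
  have hy := onlyIn_Lam y (1 : Fin 2)
  have hx := onlyIn_Lam x (0 : Fin 2)
  let l : Fin 2 →₀ ℕ := Finsupp.single 0 m + Finsupp.single 1 n
  have l0 : l 0 = m := by simp [l]
  have l1 : l 1 = n := by simp [l]
  have h2 := congrArg (coeff (l + (Finsupp.single 0 1 + Finsupp.single 1 1))) h1
  rw [mul_sub, mul_one, X_zero_mul_X_one, map_sub, coeff_add_mul_monomial, mul_one,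
    coeff_mul_of_onlyIn (by decide) hy hx, coeff_mul_of_onlyIn (by decide) hx hy,
    coeff_mul_of_onlyIn (by decide) hy hx] at h2
  have k0 : (l + (Finsupp.single 0 1 + Finsupp.single 1 1) : Fin 2 →₀ ℕ) 0 = m + 1 := by simp [l]
  have k1 : (l + (Finsupp.single 0 1 + Finsupp.single 1 1) : Fin 2 →₀ ℕ) 1 = n + 1 := by simp [l]
  rw [k0, k1, l0, l1] at h2
  rw [sub_eq_iff_eq_add'] at h2 ⊢
  rw [h2, add_comm]

variable {R : Type u} [CommRing R]

theorem LamB.relations : LamRelations (LamB.x R) (LamB.y R) := by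
  let f := (RingQuot.mkAlgHom R (LamRel R)).toRingHom
  refine ⟨fun m n => ?_, fun m n => ?_, ?_⟩
  · rw [← lie_eq_zero_iff]
    exact (map_ring_lie f _ _).symm.trans
      ((RingQuot.mkAlgHom_rel R (LamRel.xx m n)).trans (map_zero _))
  · rw [← lie_eq_zero_iff]
    exact (map_ring_lie f _ _).symm.trans
      ((RingQuot.mkAlgHom_rel R (LamRel.yy m n)).trans (map_zero _))
  · have hx : (Lam (LamB.x R) 0 : MvPowerSeries (Fin 2) (LamB R)) =
        map f (Lam (fx R Set.univ Set.univ) 0) := (map_Lam _ _ f).symm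
    have hy : (Lam (LamB.y R) 1 : MvPowerSeries (Fin 2) (LamB R)) =
        map f (Lam (fy R Set.univ Set.univ) 1) := (map_Lam _ _ f).symm
    rw [hx, hy, ← map_geomST f, ← map_mul, ← map_mul, ← map_mul]
    ext k
    rw [coeff_map, coeff_map]
    exact RingQuot.mkAlgHom_rel R (LamRel.lam k)

theorem LamB.exists_lift [Algebra R A] {x y : ℕ+ → A} (h : LamRelations x y) :
    ∃ f : LamB R →ₐ[R] A, (∀ m, f (LamB.x R m) = x m) ∧ (∀ n, f (LamB.y R n) = y n) := by
  suffices ∃ f : LamB R →ₐ[R] A, (∀ m ∈ Set.univ, f (LamB.x R m) = x m) ∧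
      (∀ n ∈ Set.univ, f (LamB.y R n) = y n) by simpa using this
  refine exists_quotLift _ x y fun a b hab => ?_
  have hx : ∀ m, (freeLift R Set.univ Set.univ x y).toRingHom (fx R Set.univ Set.univ m) = x m :=
    fun m => freeLift_fx x y trivial
  have hy : ∀ n, (freeLift R Set.univ Set.univ x y).toRingHom (fy R Set.univ Set.univ n) = y n :=
    fun n => freeLift_fy x y trivial
  change (freeLift R Set.univ Set.univ x y).toRingHom a =
    (freeLift R Set.univ Set.univ x y).toRingHom b
  induction hab with
  | xx m n =>
    rw [map_ring_lie, hx m, hx n, map_zero, lie_eq_zero_iff]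
    exact h.xx m n
  | yy m n =>
    rw [map_ring_lie, hy m, hy n, map_zero, lie_eq_zero_iff]
    exact h.yy m n
  | lam k =>
    have e : map (freeLift R Set.univ Set.univ x y).toRingHom
          (Lam (fy R Set.univ Set.univ) 1 * Lam (fx R Set.univ Set.univ) 0) =
        map (freeLift R Set.univ Set.univ x y).toRingHom (Lam (fx R Set.univ Set.univ) (0 : Fin 2) *
          Lam (fy R Set.univ Set.univ) 1 * geomST _) := by
      rw [map_mul, map_mul, map_mul, map_geomST, map_Lam, map_Lam]
      simp only [hx, hy]
      exact h.lam
    exact congrArg (coeff k) e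

/-- `B'(R)` is spanned by the products of polynomials in `x` and polynomials in `y`. -/
theorem LamB.mem_adjoin_mul_adjoin (z : LamB R) :
    z ∈ Subalgebra.toSubmodule (Algebra.adjoin R (LamB.x R '' Set.univ)) *
      Subalgebra.toSubmodule (Algebra.adjoin R (LamB.y R '' Set.univ)) := by
  -- Normal ordering is done with the coefficients of `Λ`: they generate the same algebras, and the
  -- commutator of `v (n+1)` and `u (m+1)` is `v n * u m`, with a smaller index on `v`.
  let u : ℕ → LamB R := fun m => coeff (Finsupp.single (0 : Fin 2) m) (Lam (LamB.x R) 0)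
  let v : ℕ → LamB R := fun n => coeff (Finsupp.single (1 : Fin 2) n) (Lam (LamB.y R) 1)
  have hu : Algebra.adjoin R (Set.range u) = Algebra.adjoin R (Set.range (LamB.x R)) :=
    adjoin_coeff_Lam _ _
  have hv : Algebra.adjoin R (Set.range v) = Algebra.adjoin R (Set.range (LamB.y R)) :=
    adjoin_coeff_Lam _ _
  have u0 : u 0 = 1 := by
    simp only [u, Finsupp.single_zero, coeff_Lam, Finsupp.zero_apply, lamProd_zero, coeff_zero_one]
  have v0 : v 0 = 1 := by
    simp only [v, Finsupp.single_zero, coeff_Lam, Finsupp.zero_apply, lamProd_zero, coeff_zero_one]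
  rw [Set.image_univ, Set.image_univ, ← hu, ← hv]
  refine adjoin_union_le_mul u v (fun m n => ?_) ?_
  · rcases n with _ | n
    · rw [v0, one_mul, mul_one, sub_self]; exact Subalgebra.zero_mem _
    rcases m with _ | m
    · rw [u0, one_mul, mul_one, sub_self]; exact Subalgebra.zero_mem _
    have : v (n + 1) * u (m + 1) - u (m + 1) * v (n + 1) = v n * u m :=
      LamB.relations.coeff_commutator m n
    rw [this]
    exact Subalgebra.mul_mem _ (Algebra.subset_adjoin (Or.inr ⟨n, n.lt_succ_self, rfl⟩))
      (Algebra.subset_adjoin (Or.inl ⟨m, rfl⟩))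
  · have h : Algebra.adjoin R (LamB.x R '' Set.univ ∪ LamB.y R '' Set.univ) = ⊤ :=
      adjoin_quot (LamRel R)
    rw [Set.image_univ, Set.image_univ, Algebra.adjoin_union, ← hu, ← hv,
      ← Algebra.adjoin_union] at h
    rw [h]
    trivial

end LamB

/-! ### Normal ordering in `B_{P,Q}(R)` and in `B'(ℚ)` -/

section GhostNormal

variable {R A : Type*} [CommRing R] [Ring A] [Algebra R A] {P Q : Set ℕ+} {x y : ℕ+ → A}

/-- In terms of the ghost components, which generate the same algebras, all commutators are scalars.
-/
theorem GhostRelations.adjoin_union_le (h : GhostRelations P Q x y) (hP : IsTruncationSet P)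
    (hQ : IsTruncationSet Q) (uP : ∀ m ∈ P, IsUnit ((m : ℕ) : R))
    (uQ : ∀ n ∈ Q, IsUnit ((n : ℕ) : R)) :
    Subalgebra.toSubmodule (Algebra.adjoin R (x '' P ∪ y '' Q)) ≤
      Subalgebra.toSubmodule (Algebra.adjoin R (x '' P)) *
        Subalgebra.toSubmodule (Algebra.adjoin R (y '' Q)) := by
  rw [Algebra.adjoin_union, ← adjoin_ghost hP uP, ← adjoin_ghost hQ uQ, ← Algebra.adjoin_union,
    Set.image_eq_range, Set.image_eq_range]
  refine adjoin_union_le_mul _ _ fun m n => ?_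
  rw [← Ring.lie_def, h.yx m m.2 n n.2]
  split_ifs
  exacts [natCast_mem _ _, Subalgebra.zero_mem _]

theorem ring_lie_skew (a b : A) : ⁅a, b⁆ = -⁅b, a⁆ := by
  simp [Ring.lie_def]

theorem lie_mem_of_mem_adjoin {K : Subalgebra R A} {s : Set A} (hs : s ⊆ K) {a : A}
    (h : ∀ b ∈ s, ⁅a, b⁆ ∈ K) {z : A} (hz : z ∈ Algebra.adjoin R s) : ⁅a, z⁆ ∈ K := by
  have hK : Algebra.adjoin R s ≤ K := Algebra.adjoin_le_iff.2 hs
  induction hz using Algebra.adjoin_induction with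
  | mem b hb => exact h b hb
  | algebraMap r =>
    rw [lie_eq_zero_iff.2 (Algebra.commute_algebraMap_right r a)]
    exact K.zero_mem
  | add b c _ _ ihb ihc =>
    have : ⁅a, b + c⁆ = ⁅a, b⁆ + ⁅a, c⁆ := by
      simp only [Ring.lie_def]; noncomm_ring
    rw [this]
    exact K.add_mem ihb ihc
  | mul b c hb hc ihb ihc =>
    have : ⁅a, b * c⁆ = ⁅a, b⁆ * c + b * ⁅a, c⁆ := by
      simp only [Ring.lie_def]; noncomm_ring
    rw [this]
    exact K.add_mem (K.mul_mem ihb (hK hc)) (K.mul_mem (hK hb) ihc)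

/-- Write `n y_n` and `m x_m` as ghost component minus tail and expand the bracket. The tails are
polynomials in ghost components indexed by proper divisors, and brackets of ghost components are
scalars, so all four terms lie in `K`. -/
theorem GhostRelations.lie_mem [Algebra ℚ A] (h : GhostRelations Set.univ Set.univ x y)
    (m n : ℕ+) : ⁅y n, x m⁆ ∈ Algebra.adjoin ℚ (x '' properDivisors m ∪ y '' properDivisors n) := by
  set K := Algebra.adjoin ℚ (x '' properDivisors m ∪ y '' properDivisors n)
  have hxK : Algebra.adjoin ℚ (x '' properDivisors m) ≤ K :=
    Algebra.adjoin_mono Set.subset_union_left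
  have hyK : Algebra.adjoin ℚ (y '' properDivisors n) ≤ K :=
    Algebra.adjoin_mono Set.subset_union_right
  have hgx := adjoin_ghost (R := ℚ) (isTruncationSet_properDivisors m)
    (fun k _ => isUnit_pnat_rat k) x
  have hgy := adjoin_ghost (R := ℚ) (isTruncationSet_properDivisors n)
    (fun k _ => isUnit_pnat_rat k) y
  have hrx : ghostTail x m ∈ Algebra.adjoin ℚ (x '' properDivisors m) :=
    ghostTail_mem _ fun d hd => Algebra.subset_adjoin (Set.mem_image_of_mem _ hd)
  have hry : ghostTail y n ∈ Algebra.adjoin ℚ (y '' properDivisors n) :=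
    ghostTail_mem _ fun d hd => Algebra.subset_adjoin (Set.mem_image_of_mem _ hd)
  have hconst : ∀ k l, ⁅ghost y k, ghost x l⁆ ∈ K := fun k l => by
    rw [h.yx l trivial k trivial]
    split_ifs
    exacts [natCast_mem _ _, K.zero_mem]
  have h1 : ⁅ghost y n, ghostTail x m⁆ ∈ K := by
    rw [← hgx] at hrx hxK
    refine lie_mem_of_mem_adjoin (Algebra.adjoin_le_iff.1 hxK) ?_ hrx
    rintro _ ⟨d, -, rfl⟩
    exact hconst n d
  have h2 : ⁅ghostTail y n, ghost x m⁆ ∈ K := by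
    rw [← hgy] at hry hyK
    rw [ring_lie_skew]
    refine K.neg_mem (lie_mem_of_mem_adjoin (Algebra.adjoin_le_iff.1 hyK) ?_ hry)
    rintro _ ⟨d, -, rfl⟩
    rw [ring_lie_skew]
    exact K.neg_mem (hconst d m)
  have h3 : ⁅ghostTail y n, ghostTail x m⁆ ∈ K := by
    rw [Ring.lie_def]
    exact K.sub_mem (K.mul_mem (hyK hry) (hxK hrx)) (K.mul_mem (hxK hrx) (hyK hry))
  have key : (((n : ℕ) : ℚ) * ((m : ℕ) : ℚ)) • ⁅y n, x m⁆ = ⁅ghost y n, ghost x m⁆ -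
      ⁅ghost y n, ghostTail x m⁆ - ⁅ghostTail y n, ghost x m⁆ + ⁅ghostTail y n, ghostTail x m⁆ := by
    have ex : ghost x m = ((m : ℕ) : ℚ) • x m + ghostTail x m := by
      rw [ghost_eq, Algebra.smul_def, map_natCast]
    have ey : ghost y n = ((n : ℕ) : ℚ) • y n + ghostTail y n := by
      rw [ghost_eq, Algebra.smul_def, map_natCast]
    rw [ex, ey]
    simp only [Ring.lie_def, mul_add, add_mul, smul_add, smul_sub, smul_mul_assoc,
      mul_smul_comm, mul_smul, smul_comm ((m : ℕ) : ℚ) ((n : ℕ) : ℚ)]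
    abel
  have hne : ((n : ℕ) : ℚ) * ((m : ℕ) : ℚ) ≠ 0 := by
    have := n.ne_zero; have := m.ne_zero; positivity
  rw [← one_smul ℚ ⁅y n, x m⁆, ← inv_mul_cancel₀ hne, ← smul_smul, key]
  exact K.smul_mem (K.add_mem (K.sub_mem (K.sub_mem (hconst n m) h1) h2) h3) _

theorem StructRelations.map {B : Type*} [Ring B] {c : ℕ+ → ℕ+ → OrdPoly ℤ}
    (h : StructRelations c P Q x y) (f : A →+* B) :
    StructRelations c P Q (fun m => f (x m)) (fun n => f (y n)) where
  xx m hm n hn := (h.xx m hm n hn).map f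
  yy m hm n hn := (h.yy m hm n hn).map f
  yx m hm n hn := by
    rw [← map_ring_lie, h.yx m hm n hn, OrdPoly.map_eval_int]

theorem OrdPoly.IsIn.eval_mem_subalgebra {p : OrdPoly ℤ} (hp : p.IsIn P Q) (K : Subalgebra R A)
    (hx : ∀ d ∈ P, x d ∈ K) (hy : ∀ e ∈ Q, y e ∈ K) : p.eval x y ∈ K := by
  have h : Algebra.adjoin ℤ (x '' P ∪ y '' Q) ≤ subalgebraOfSubring K.toSubring := by
    rw [Algebra.adjoin_le_iff]
    rintro _ (⟨d, hd, rfl⟩ | ⟨e, he, rfl⟩)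
    exacts [hx d hd, hy e he]
  exact h (hp.eval_mem x y)

/-- Reordering terminates because `c m n` only involves `y_e` with `e` a proper divisor of `n`. -/
theorem StructRelations.adjoin_union_le {c : ℕ+ → ℕ+ → OrdPoly ℤ}
    (hc : ∀ m n, (c m n).IsIn (properDivisors m) (properDivisors n))
    (h : StructRelations c P Q x y) (hP : IsTruncationSet P) (hQ : IsTruncationSet Q) :
    Subalgebra.toSubmodule (Algebra.adjoin R (x '' P ∪ y '' Q)) ≤
      Subalgebra.toSubmodule (Algebra.adjoin R (x '' P)) *
        Subalgebra.toSubmodule (Algebra.adjoin R (y '' Q)) := by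
  rw [Set.image_eq_range, Set.image_eq_range]
  refine adjoin_union_le_mul _ _ fun m n => ?_
  rw [← Ring.lie_def, h.yx m m.2 n n.2]
  refine (hc m n).eval_mem_subalgebra _ (fun d hd => ?_) (fun e he => ?_)
  · exact Algebra.subset_adjoin (Or.inl ⟨⟨d, hP.properDivisors_subset m.2 hd⟩, rfl⟩)
  · exact Algebra.subset_adjoin (Or.inr ⟨⟨e, hQ.properDivisors_subset n.2 he⟩,
      lt_of_mem_properDivisors he, rfl⟩)

end GhostNormal

/-! ### The comparison of `B'(ℚ)` with `B(ℚ)` -/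

section Rational

/-- The generators `x_m` of `B(ℚ)`. -/
abbrev ratX : ℕ+ → GhostB ℚ Set.univ Set.univ := GhostB.x ℚ Set.univ Set.univ

/-- The generators `y_n` of `B(ℚ)`. -/
abbrev ratY : ℕ+ → GhostB ℚ Set.univ Set.univ := GhostB.y ℚ Set.univ Set.univ

theorem ratX_commute (m n : ℕ+) : Commute (ratX m) (ratX n) :=
  commute_of_ghost_commute (R := ℚ) isTruncationSet_univ (fun k _ => isUnit_pnat_rat k)
    GhostB.relations.xx m trivial n trivial

theorem ratY_commute (m n : ℕ+) : Commute (ratY m) (ratY n) :=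
  commute_of_ghost_commute (R := ℚ) isTruncationSet_univ (fun k _ => isUnit_pnat_rat k)
    GhostB.relations.yy m trivial n trivial

/-- Evaluation is the linear combination map of the monomials, so this is their independence
unfolded. -/
theorem rat_eval_injective : Function.Injective fun p : OrdPoly ℚ => p.eval ratX ratY :=
  GhostB.linearIndependent

theorem rat_lamRelations : LamRelations ratX ratY :=
  haveI : IsAddTorsionFree (GhostB ℚ Set.univ Set.univ) := IsAddTorsionFree.of_module_rat _
  GhostB.relations.lamRelations ratX_commute ratY_commute

/-- The isomorphism `B'(ℚ) = B(ℚ)`. -/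
theorem exists_lamB_equiv_ghostB : ∃ e : LamB ℚ ≃ₐ[ℚ] GhostB ℚ Set.univ Set.univ,
    (∀ m, e (LamB.x ℚ m) = ratX m) ∧ (∀ n, e (LamB.y ℚ n) = ratY n) := by
  obtain ⟨f, hx, hy⟩ := LamB.exists_lift (R := ℚ) rat_lamRelations
  refine ⟨AlgEquiv.ofBijective f ⟨?_, ?_⟩, hx, hy⟩
  -- Every element of `B'(ℚ)` is a normally ordered polynomial, and in `B(ℚ)` such a polynomial
  -- vanishes only if its coefficients do.
  · rw [injective_iff_map_eq_zero]
    intro z hz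
    obtain ⟨p, -, rfl⟩ := exists_eval_eq (fun m _ n _ => LamB.relations.xx m n)
      (fun m _ n _ => LamB.relations.yy m n) (LamB.mem_adjoin_mul_adjoin z)
    rw [OrdPoly.map_eval, funext hx, funext hy] at hz
    have hp : p = 0 := rat_eval_injective (hz.trans (by simp [OrdPoly.eval]))
    simp [hp, OrdPoly.eval]
  · rw [← AlgHom.range_eq_top, eq_top_iff, ← adjoin_quot (GhostRel ℚ Set.univ Set.univ),
      Algebra.adjoin_le_iff]
    rintro _ (⟨m, -, rfl⟩ | ⟨n, -, rfl⟩)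
    · exact ⟨_, hx m⟩
    · exact ⟨_, hy n⟩

end Rational

/-! ### The structure polynomials -/

section Structure

/-- The polynomials `c_{m,n}` are characterized by their support and their values in `B(ℚ)`. -/
structure IsStructureFamily (c : ℕ+ → ℕ+ → OrdPoly ℤ) : Prop where
  isIn : ∀ m n, (c m n).IsIn (properDivisors m) (properDivisors n)
  rat : ∀ m n, ⁅ratY n, ratX m⁆ = (c m n).eval ratX ratY

/-- `B'(ℤ)` is universal: an identity with integer coefficients there maps to every family
satisfying the `Λ`-relations. -/
theorem LamRelations.lie_eq {A : Type*} [Ring A] {x y : ℕ+ → A} (h : LamRelations x y)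
    {p : OrdPoly ℤ} {m n : ℕ+} (hp : ⁅LamB.y ℤ n, LamB.x ℤ m⁆ = p.eval (LamB.x ℤ) (LamB.y ℤ)) :
    ⁅y n, x m⁆ = p.eval x y := by
  obtain ⟨f, hx, hy⟩ := LamB.exists_lift (R := ℤ) h
  have hf := congrArg f.toRingHom hp
  rw [map_ring_lie, OrdPoly.map_eval_int] at hf
  have hx' : ∀ m, f.toRingHom (LamB.x ℤ m) = x m := hx
  have hy' : ∀ m, f.toRingHom (LamB.y ℤ m) = y m := hy
  simpa only [hx', hy'] using hf

/-- The structure polynomials exist, and they are the ones of `B'(R)` for every `R`. -/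
theorem exists_isStructureFamily : ∃ c : ℕ+ → ℕ+ → OrdPoly ℤ, IsStructureFamily c ∧
    ∀ (R : Type u) [CommRing R] (m n : ℕ+),
      ⁅LamB.y R n, LamB.x R m⁆ = (c m n).eval (LamB.x R) (LamB.y R) := by
  have hex : ∀ m n : ℕ+, ∃ p : OrdPoly ℤ,
      ⁅LamB.y ℤ n, LamB.x ℤ m⁆ = p.eval (LamB.x ℤ) (LamB.y ℤ) := fun m n => by
    obtain ⟨p, -, hp⟩ := exists_eval_eq (fun m _ n _ => LamB.relations.xx m n)
      (fun m _ n _ => LamB.relations.yy m n)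
      (LamB.mem_adjoin_mul_adjoin ⁅LamB.y ℤ n, LamB.x ℤ m⁆)
    exact ⟨p, hp⟩
  choose c hc using hex
  refine ⟨c, ⟨fun m n => ?_, fun m n => rat_lamRelations.lie_eq (hc m n)⟩,
    fun R _ m n => LamB.relations.lie_eq (hc m n)⟩
  -- Which variables occur is decided in `B(ℚ)`: the bracket lies in the algebra of proper-divisor
  -- generators, and normal ordering inside it gives a rational polynomial, equal to `c m n` by
  -- uniqueness.
  have hle := GhostB.relations.lie_mem (A := GhostB ℚ Set.univ Set.univ) m n
  obtain ⟨p, hp, hpe⟩ := exists_eval_eq (fun k _ l _ => ratX_commute k l)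
    (fun k _ l _ => ratY_commute k l)
    ((GhostB.relations.mono (Set.subset_univ _) (Set.subset_univ _)).adjoin_union_le
      (isTruncationSet_properDivisors m) (isTruncationSet_properDivisors n)
      (fun k _ => isUnit_pnat_rat k) (fun k _ => isUnit_pnat_rat k) hle)
  have e : p = (c m n).toRat := rat_eval_injective (by
    dsimp only
    rw [← hpe, OrdPoly.eval_toRat]
    exact rat_lamRelations.lie_eq (hc m n))
  intro ij hij
  refine hp ij ?_
  rw [e]
  simpa [OrdPoly.toRat] using hij

variable {c : ℕ+ → ℕ+ → OrdPoly ℤ}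

theorem IsStructureFamily.rat_iff (hc : IsStructureFamily c) (m n : ℕ+) (p : OrdPoly ℚ) :
    ⁅ratY n, ratX m⁆ = p.eval ratX ratY ↔ p = (c m n).toRat := by
  have h1 : ⁅ratY n, ratX m⁆ = (c m n).toRat.eval ratX ratY := by
    rw [OrdPoly.eval_toRat]; exact hc.rat m n
  rw [h1]
  exact ⟨fun h => rat_eval_injective h.symm, fun h => by rw [h]⟩

theorem OrdPoly.eval_mapRange {S S' A : Type*} [CommRing S] [CommRing S'] [Ring A] [Algebra S A]
    [Algebra S' A] (j : S →+* S') (hj : ∀ (s : S) (z : A), j s • z = s • z) (p : OrdPoly S)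
    (x y : ℕ+ → A) :
    OrdPoly.eval (S := S') (Finsupp.mapRange j (map_zero j) p) x y = p.eval x y := by
  unfold OrdPoly.eval
  rw [Finsupp.sum_mapRange_index (by simp)]
  exact Finsupp.sum_congr fun ij _ => hj _ _

theorem GhostRelations.lie_eq {S A : Type*} [CommRing S] [Ring A] [Algebra S A] {P Q : Set ℕ+}
    (hP : IsTruncationSet P) (hQ : IsTruncationSet Q) {x y : ℕ+ → A} (h : GhostRelations P Q x y)
    {m n : ℕ+} (hm : m ∈ P) (hn : n ∈ Q) {p : OrdPoly S} (hp : p.IsIn P Q)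
    (hpe : ⁅GhostB.y S P Q n, GhostB.x S P Q m⁆ = p.eval (GhostB.x S P Q) (GhostB.y S P Q)) :
    ⁅y n, x m⁆ = p.eval x y := by
  obtain ⟨f, hx, hy⟩ := GhostB.exists_lift (R := S) hP hQ h
  have hf := congrArg f hpe
  rw [OrdPoly.map_eval, hp.eval_congr hx hy] at hf
  rw [← hf, ← hx m hm, ← hy n hn]
  exact (map_ring_lie f.toRingHom _ _).symm

/-- The commutators in `B_{P,Q}(S)` for a ring `S ⊆ ℚ`. -/
theorem IsStructureFamily.ghost_of_injective (hc : IsStructureFamily c) {S : Type*} [CommRing S]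
    (j : S →+* ℚ) (hj : Function.Injective j) {A : Type*} [Ring A] [Algebra S A] {P Q : Set ℕ+}
    (hP : IsTruncationSet P) (hQ : IsTruncationSet Q) (uP : ∀ m ∈ P, IsUnit ((m : ℕ) : S))
    (uQ : ∀ n ∈ Q, IsUnit ((n : ℕ) : S)) {x y : ℕ+ → A} (h : GhostRelations P Q x y) {m n : ℕ+}
    (hm : m ∈ P) (hn : n ∈ Q) : ⁅y n, x m⁆ = (c m n).eval x y := by
  -- The normal form has coefficients in `S`; since `S` embeds in `ℚ`, comparison in `B(ℚ)`
  -- identifies it with `c m n`.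
  obtain ⟨p, hp, hpe⟩ : ∃ p : OrdPoly S, p.IsIn P Q ∧
      ⁅GhostB.y S P Q n, GhostB.x S P Q m⁆ = p.eval (GhostB.x S P Q) (GhostB.y S P Q) := by
    refine exists_eval_eq (commute_of_ghost_commute hP uP GhostB.relations.xx)
      (commute_of_ghost_commute hQ uQ GhostB.relations.yy)
      (GhostB.relations.adjoin_union_le hP hQ uP uQ ?_)
    have hx : GhostB.x S P Q m ∈
        Algebra.adjoin S (GhostB.x S P Q '' P ∪ GhostB.y S P Q '' Q) :=
      Algebra.subset_adjoin (Or.inl (Set.mem_image_of_mem _ hm))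
    have hy : GhostB.y S P Q n ∈
        Algebra.adjoin S (GhostB.x S P Q '' P ∪ GhostB.y S P Q '' Q) :=
      Algebra.subset_adjoin (Or.inr (Set.mem_image_of_mem _ hn))
    rw [Ring.lie_def]
    exact Subalgebra.sub_mem _ (Subalgebra.mul_mem _ hy hx) (Subalgebra.mul_mem _ hx hy)
  let : Algebra S (GhostB ℚ Set.univ Set.univ) := Algebra.compHom _ j
  have h1 : ⁅ratY n, ratX m⁆ = p.eval ratX ratY :=
    (GhostB.relations.mono (Set.subset_univ _) (Set.subset_univ _)).lie_eq hP hQ hm hn hp hpe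
  rw [← OrdPoly.eval_mapRange j (fun _ _ => rfl), hc.rat_iff] at h1
  have h2 : p = (c m n).mapRange (Int.castRingHom S) (map_zero _) := by
    ext ij
    have := DFunLike.congr_fun h1 ij
    simp only [OrdPoly.toRat, Finsupp.mapRange_apply] at this
    apply hj
    simp [this]
  rw [h.lie_eq hP hQ hm hn hp hpe, h2, OrdPoly.eval_mapRange (Int.castRingHom S)]
  intro r z
  simp [Int.cast_smul_eq_zsmul]

/-- The commutators in `B_{P,Q}(R)` when the elements of `P` and `Q` are invertible in `R`. -/
theorem IsStructureFamily.ghost (hc : IsStructureFamily c) {R A : Type*} [CommRing R] [Ring A]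
    [Algebra R A] {P Q : Set ℕ+} (hP : IsTruncationSet P) (hQ : IsTruncationSet Q)
    (uP : ∀ m ∈ P, IsUnit ((m : ℕ) : R)) (uQ : ∀ n ∈ Q, IsUnit ((n : ℕ) : R)) {x y : ℕ+ → A}
    (h : GhostRelations P Q x y) {m n : ℕ+} (hm : m ∈ P) (hn : n ∈ Q) :
    ⁅y n, x m⁆ = (c m n).eval x y := by
  -- For the zero ring `M` below would contain `0`, and the localization would not embed in `ℚ`.
  rcases subsingleton_or_nontrivial R with hR | hR
  · have := Module.subsingleton R A
    exact Subsingleton.elim _ _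
  -- Inverting exactly the integers that are units in `R` gives a ring which maps to `R`, embeds in
  -- `ℚ`, and still has the elements of `P` and `Q` invertible.
  let M : Submonoid ℤ := (IsUnit.submonoid R).comap (Int.castRingHom R)
  have hM : ∀ s : M, IsUnit (Int.castRingHom R s) := fun s => s.2
  have hM0 : M ≤ nonZeroDivisors ℤ := by
    intro s hs
    rw [mem_nonZeroDivisors_iff_ne_zero]
    rintro rfl
    simp [M, IsUnit.mem_submonoid_iff] at hs
  have hMQ : ∀ s : M, IsUnit (Int.castRingHom ℚ s) := fun s =>
    (Int.cast_ne_zero.2 (nonZeroDivisors.ne_zero (hM0 s.2))).isUnit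
  let g : Localization M →+* R := IsLocalization.lift hM
  let j : Localization M →+* ℚ := IsLocalization.lift hMQ
  have hj : Function.Injective j := by
    refine (IsLocalization.lift_injective_iff hMQ).2 fun a b => ?_
    rw [(IsLocalization.injective (Localization M) hM0).eq_iff,
      (RingHom.injective_int (Int.castRingHom ℚ)).eq_iff]
  have hu : ∀ k : ℕ+, IsUnit ((k : ℕ) : R) → IsUnit ((k : ℕ) : Localization M) := by
    intro k hk
    have : ((k : ℕ) : ℤ) ∈ M := by simpa [M, IsUnit.mem_submonoid_iff] using hk
    simpa using IsLocalization.map_units (Localization M) ⟨((k : ℕ) : ℤ), this⟩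
  let : Algebra (Localization M) A := Algebra.compHom A g
  exact hc.ghost_of_injective j hj hP hQ (fun k hk => hu k (uP k hk)) (fun k hk => hu k (uQ k hk))
    h hm hn

/-- The defining relations of `B^c_{P,Q}` hold in `B_{P,Q}(R)`. -/
theorem IsStructureFamily.structRelations_of_ghost (hc : IsStructureFamily c) {R A : Type*}
    [CommRing R] [Ring A] [Algebra R A] {P Q : Set ℕ+} (hP : IsTruncationSet P)
    (hQ : IsTruncationSet Q) (uP : ∀ m ∈ P, IsUnit ((m : ℕ) : R))
    (uQ : ∀ n ∈ Q, IsUnit ((n : ℕ) : R)) {x y : ℕ+ → A} (h : GhostRelations P Q x y) :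
    StructRelations c P Q x y where
  xx := commute_of_ghost_commute hP uP h.xx
  yy := commute_of_ghost_commute hQ uQ h.yy
  yx _ hm _ hn := hc.ghost hP hQ uP uQ h hm hn

end Structure

/-! ### The basis of `B^c_{P,Q}(R)` -/

section Basis

variable {c : ℕ+ → ℕ+ → OrdPoly ℤ} {P Q : Set ℕ+}

/-- The products `x^i y^j` in `B^c_{P,Q}(R)`. -/
def StructB.monomials (c : ℕ+ → ℕ+ → OrdPoly ℤ) (R : Type u) [CommRing R] (P Q : Set ℕ+)
    (ij : (P →₀ ℕ) × (Q →₀ ℕ)) : StructB c R P Q :=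
  mono (fun m : P => StructB.x c R P Q m) ij.1 * mono (fun n : Q => StructB.y c R P Q n) ij.2

theorem IsStructureFamily.span_monomials (hc : IsStructureFamily c) (hP : IsTruncationSet P)
    (hQ : IsTruncationSet Q) (R : Type u) [CommRing R] :
    ⊤ ≤ Submodule.span R (Set.range (StructB.monomials c R P Q)) := by
  have h := StructB.relations (R := R) (P := P) (Q := Q) c
  have h1 := h.adjoin_union_le (R := R) hc.isIn hP hQ
  have h2 : Algebra.adjoin R (StructB.x c R P Q '' P ∪ StructB.y c R P Q '' Q) = ⊤ :=
    adjoin_quot (StructRel c R P Q)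
  rw [h2, adjoin_mul_adjoin_eq_span h.xx h.yy] at h1
  exact h1

/-- The generators of `B(ℚ)` indexed by `P` and `Q` satisfy the structure relations, and the
monomials become a subfamily of an independent one. -/
theorem IsStructureFamily.exists_toRat (hc : IsStructureFamily c) (hP : IsTruncationSet P)
    (hQ : IsTruncationSet Q) : ∃ f : StructB c ℤ P Q →ₐ[ℤ] GhostB ℚ Set.univ Set.univ,
      (∀ m ∈ P, f (StructB.x c ℤ P Q m) = ratX m) ∧
      (∀ n ∈ Q, f (StructB.y c ℤ P Q n) = ratY n) ∧
      LinearIndependent ℤ (f ∘ StructB.monomials c ℤ P Q) := by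
  obtain ⟨f, hx, hy⟩ := StructB.exists_lift (R := ℤ) hc.isIn hP hQ
    (hc.structRelations_of_ghost (R := ℚ) hP hQ (fun k _ => isUnit_pnat_rat k)
      (fun k _ => isUnit_pnat_rat k)
      ((GhostB.relations (R := ℚ) (P := Set.univ) (Q := Set.univ)).mono (Set.subset_univ _)
        (Set.subset_univ _)))
  refine ⟨f, hx, hy, ?_⟩
  have h1 : LinearIndependent ℤ
      (fun ij : (ℕ+ →₀ ℕ) × (ℕ+ →₀ ℕ) => mono ratX ij.1 * mono ratY ij.2) :=
    GhostB.linearIndependent.restrict_scalars (fun a b hab => by simpa using hab)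
  have h2 := h1.comp
    (Prod.map (Finsupp.embDomain (Function.Embedding.subtype (· ∈ P)))
      (Finsupp.embDomain (Function.Embedding.subtype (· ∈ Q))))
    (Function.Injective.prodMap (Finsupp.embDomain_injective _) (Finsupp.embDomain_injective _))
  convert h2 using 1
  funext ij
  simp only [Function.comp_apply, StructB.monomials, map_mul, map_mono, fun m : P => hx m m.2,
    fun n : Q => hy n n.2]
  rw [mono_subtype, mono_subtype]
  rfl

/-- The monomials `x^i y^j` form a basis of `B^c_{P,Q}(ℤ)`. -/
theorem IsStructureFamily.exists_basis_int (hc : IsStructureFamily c) (hP : IsTruncationSet P)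
    (hQ : IsTruncationSet Q) :
    ∃ b : Module.Basis ((P →₀ ℕ) × (Q →₀ ℕ)) ℤ (StructB c ℤ P Q),
      ⇑b = StructB.monomials c ℤ P Q := by
  obtain ⟨f, -, -, hli⟩ := hc.exists_toRat hP hQ
  exact ⟨.mk (LinearIndependent.of_comp f.toLinearMap hli) (hc.span_monomials hP hQ ℤ),
    Module.Basis.coe_mk _ _⟩

theorem IsStructureFamily.toRat_injective (hc : IsStructureFamily c) (hP : IsTruncationSet P)
    (hQ : IsTruncationSet Q) : ∃ f : StructB c ℤ P Q →ₐ[ℤ] GhostB ℚ Set.univ Set.univ,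
      (∀ m ∈ P, f (StructB.x c ℤ P Q m) = ratX m) ∧
      (∀ n ∈ Q, f (StructB.y c ℤ P Q n) = ratY n) ∧ Function.Injective f := by
  obtain ⟨f, hx, hy, hli⟩ := hc.exists_toRat hP hQ
  obtain ⟨b, hb⟩ := hc.exists_basis_int hP hQ
  refine ⟨f, hx, hy, (injective_iff_map_eq_zero f).2 fun z hz => ?_⟩
  rw [← hb] at hli
  rw [← b.linearCombination_repr z] at hz ⊢
  have h1 : Finsupp.linearCombination ℤ (f ∘ b) (b.repr z) = 0 := by
    rw [← hz]
    exact (Finsupp.apply_linearCombination ℤ f.toLinearMap b (b.repr z)).symm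
  rw [linearIndependent_iff.1 hli _ h1, map_zero]

/-- Take `T = R ⊗ B`. The existential form retains only what the transfer of independence from `ℤ`
to `R` needs. -/
theorem exists_baseChange {ι : Type*} {B : Type v} (R : Type u) [CommRing R] [Ring B]
    (b : Module.Basis ι ℤ B) : ∃ (T : Type (max u v)) (_ : Ring T) (_ : Algebra R T) (i : B →+* T),
      LinearIndependent R (i ∘ b) := by
  refine ⟨TensorProduct ℤ R B, inferInstance, inferInstance,
    (Algebra.TensorProduct.includeRight : B →ₐ[ℤ] TensorProduct ℤ R B).toRingHom, ?_⟩
  have e : ⇑(b.baseChange R) =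
      (Algebra.TensorProduct.includeRight : B →ₐ[ℤ] TensorProduct ℤ R B) ∘ b :=
    funext fun k => Module.Basis.baseChange_apply _ _ _
  have h := (b.baseChange R).linearIndependent
  rw [e] at h
  exact h

/-- The monomials `x^i y^j` form a basis of `B^c_{P,Q}(R)`. -/
theorem IsStructureFamily.exists_basis (hc : IsStructureFamily c) (hP : IsTruncationSet P)
    (hQ : IsTruncationSet Q) (R : Type u) [CommRing R] :
    ∃ b : Module.Basis ((P →₀ ℕ) × (Q →₀ ℕ)) R (StructB c R P Q),
      ∀ ij, b ij = StructB.monomials c R P Q ij := by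
  obtain ⟨b, hb⟩ := hc.exists_basis_int hP hQ
  obtain ⟨T, _, _, i, hi⟩ := exists_baseChange R b
  -- The map to the base change of `B^c_{P,Q}(ℤ)` sends monomials to an independent family.
  obtain ⟨f, hx, hy⟩ := StructB.exists_lift (R := R) hc.isIn hP hQ
    ((StructB.relations (R := ℤ) (P := P) (Q := Q) c).map i)
  have hli : LinearIndependent R (f.toLinearMap ∘ StructB.monomials c R P Q) := by
    convert hi using 1
    funext ij
    simp only [Function.comp_apply, hb, StructB.monomials, AlgHom.toLinearMap_apply, map_mul,
      map_mono, fun m : P => hx m m.2, fun n : Q => hy n n.2]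
  exact ⟨.mk hli.of_comp (hc.span_monomials hP hQ R), fun ij => Module.Basis.mk_apply _ _ ij⟩

/-- The ghost relations hold in `B(ℚ)`, hence in `B^c_{P,Q}(ℤ)`, which embeds there, hence in its
image in `B^c_{P,Q}(R)`. No invertibility is needed in this direction. -/
theorem IsStructureFamily.structB_ghostRelations (hc : IsStructureFamily c)
    (hP : IsTruncationSet P) (hQ : IsTruncationSet Q) (R : Type u) [CommRing R] :
    GhostRelations P Q (StructB.x c R P Q) (StructB.y c R P Q) := by
  obtain ⟨f, hx, hy, hf⟩ := hc.toRat_injective hP hQ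
  have h1 : GhostRelations P Q (StructB.x c ℤ P Q) (StructB.y c ℤ P Q) :=
    GhostRelations.of_injective f.toRingHom hf
      (((GhostB.relations (R := ℚ) (P := Set.univ) (Q := Set.univ)).mono (Set.subset_univ P)
        (Set.subset_univ Q)).congr hP hQ hx hy)
  obtain ⟨g, gx, gy⟩ := StructB.exists_lift (R := ℤ) hc.isIn hP hQ
    (StructB.relations (R := R) (P := P) (Q := Q) c)
  exact (h1.map g.toRingHom).congr hP hQ (fun m hm => (gx m hm).symm) (fun n hn => (gy n hn).symm)

/-- `B^c_{P,Q}(R) = B_{P,Q}(R)` when the elements of `P` and `Q` are invertible in `R`. -/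
theorem IsStructureFamily.exists_equiv (hc : IsStructureFamily c) (hP : IsTruncationSet P)
    (hQ : IsTruncationSet Q) (R : Type u) [CommRing R] (uP : ∀ m ∈ P, IsUnit ((m : ℕ) : R))
    (uQ : ∀ n ∈ Q, IsUnit ((n : ℕ) : R)) :
    ∃ e : StructB c R P Q ≃ₐ[R] GhostB R P Q,
      (∀ m ∈ P, e (StructB.x c R P Q m) = GhostB.x R P Q m) ∧
      (∀ n ∈ Q, e (StructB.y c R P Q n) = GhostB.y R P Q n) := by
  obtain ⟨f, fx, fy⟩ := StructB.exists_lift (R := R) hc.isIn hP hQ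
    (hc.structRelations_of_ghost hP hQ uP uQ (GhostB.relations (R := R)))
  obtain ⟨g, gx, gy⟩ := GhostB.exists_lift (R := R) hP hQ (hc.structB_ghostRelations hP hQ R)
  refine ⟨AlgEquiv.ofAlgHom f g (quot_hom_ext (fun m hm => ?_) (fun n hn => ?_))
    (quot_hom_ext (fun m hm => ?_) (fun n hn => ?_)), fx, fy⟩
  · exact (congrArg f (gx m hm)).trans (fx m hm)
  · exact (congrArg f (gy n hn)).trans (fy n hn)
  · exact (congrArg g (fx m hm)).trans (gx m hm)
  · exact (congrArg g (fy n hn)).trans (gy n hn)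

end Basis

end UnivB

end

open UnivB in
theorem theorem2p14 :
    -- `B(ℚ) = B'(ℚ)`, generators corresponding to generators
    (∃ e : GhostB ℚ Set.univ Set.univ ≃ₐ[ℚ] LamB ℚ,
      (∀ m, e (GhostB.x ℚ Set.univ Set.univ m) = LamB.x ℚ m) ∧
      (∀ n, e (GhostB.y ℚ Set.univ Set.univ n) = LamB.y ℚ n)) ∧
    ∃ c : ℕ+ → ℕ+ → OrdPoly ℤ,
      -- `c_{m,n} ∈ ℤ[X_d ∣ d ∈ D*(m)][Y_e ∣ e ∈ D*(n)]`
      (∀ m n, (c m n).InProperDivisors m n) ∧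
      -- `c_{m,n}` is the one and only `p ∈ ℚ[X][Y]` with `[y_n, x_m] = p(x, y)` in `B(ℚ)`
      (∀ (m n : ℕ+) (p : OrdPoly ℚ),
        ⁅GhostB.y ℚ Set.univ Set.univ n, GhostB.x ℚ Set.univ Set.univ m⁆ =
            p.eval (GhostB.x ℚ Set.univ Set.univ) (GhostB.y ℚ Set.univ Set.univ) ↔
          p = (c m n).toRat) ∧
      -- the same in `B'(ℚ)`
      (∀ (m n : ℕ+) (p : OrdPoly ℚ),
        ⁅LamB.y ℚ n, LamB.x ℚ m⁆ = p.eval (LamB.x ℚ) (LamB.y ℚ) ↔ p = (c m n).toRat) ∧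
      -- `[y_n, x_m] = c_{m,n}(x, y)` in `B'(R)` for every ring `R`
      (∀ (R : Type u) [CommRing R] (m n : ℕ+),
        ⁅LamB.y R n, LamB.x R m⁆ = (c m n).eval (LamB.x R) (LamB.y R)) ∧
      -- and in `B_{P,Q}(R)` whenever `P, Q ⊆ Rˣ`
      (∀ (R : Type u) [CommRing R] (P Q : Set ℕ+), IsTruncationSet P → IsTruncationSet Q →
        (∀ m ∈ P, IsUnit ((m : ℕ) : R)) → (∀ n ∈ Q, IsUnit ((n : ℕ) : R)) →
        ∀ m ∈ P, ∀ n ∈ Q, ⁅GhostB.y R P Q n, GhostB.x R P Q m⁆ =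
          (c m n).eval (GhostB.x R P Q) (GhostB.y R P Q)) ∧
      -- the definition of `B_{P,Q}(R)` by the `c_{m,n}` extends the one by ghost components
      (∀ (R : Type u) [CommRing R] (P Q : Set ℕ+), IsTruncationSet P → IsTruncationSet Q →
        (∀ m ∈ P, IsUnit ((m : ℕ) : R)) → (∀ n ∈ Q, IsUnit ((n : ℕ) : R)) →
        ∃ e : StructB c R P Q ≃ₐ[R] GhostB R P Q,
          (∀ m ∈ P, e (StructB.x c R P Q m) = GhostB.x R P Q m) ∧
          (∀ n ∈ Q, e (StructB.y c R P Q n) = GhostB.y R P Q n)) ∧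
      -- the monomials `x^i y^j` form a basis of `B_{P,Q}(R)` for every ring `R`
      (∀ (R : Type u) [CommRing R] (P Q : Set ℕ+), IsTruncationSet P → IsTruncationSet Q →
        ∃ b : Module.Basis ((P →₀ ℕ) × (Q →₀ ℕ)) R (StructB c R P Q),
          ∀ ij, b ij = mono (fun m : P => StructB.x c R P Q m) ij.1 *
            mono (fun n : Q => StructB.y c R P Q n) ij.2) := by
  obtain ⟨e, ex, ey⟩ := exists_lamB_equiv_ghostB
  obtain ⟨c, hc, hlam⟩ := exists_isStructureFamily
  refine ⟨⟨e.symm, fun m => ?_, fun n => ?_⟩, c, hc.isIn, hc.rat_iff, fun m n p => ?_, hlam,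
    fun R _ P Q hP hQ uP uQ m hm n hn => hc.ghost hP hQ uP uQ GhostB.relations hm hn,
    fun R _ P Q hP hQ uP uQ => hc.exists_equiv hP hQ R uP uQ,
    fun R _ P Q hP hQ => hc.exists_basis hP hQ R⟩
  · rw [AlgEquiv.symm_apply_eq, ex]
  · rw [AlgEquiv.symm_apply_eq, ey]
  · have h1 : e ⁅LamB.y ℚ n, LamB.x ℚ m⁆ = ⁅ratY n, ratX m⁆ := by
      rw [← ex m, ← ey n]
      exact map_ring_lie e.toAlgHom.toRingHom _ _
    have h2 : e (p.eval (LamB.x ℚ) (LamB.y ℚ)) = p.eval ratX ratY := by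
      rw [← funext ex, ← funext ey]
      exact OrdPoly.map_eval e.toAlgHom p _ _
    rw [← hc.rat_iff, ← h1, ← h2, e.injective.eq_iff]
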